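/- **Construction.** Let $n\ge 1$, $m=\lfloor\sqrt n\rfloor$ and $N=2^{m}$. Draw independently and uniformly from $[n]$ all the variables $T_i(k)$, $C_{i,j}(k)$ ($i,j\in[N]$, $k\in[m]$) and all the indices $\kappa_{i,j}$ ($i,j\in[N]$). Say that $x\in\{0,1\}^n$ satisfies the term $T_i$ if $x_{T_i(k)}=1$ for all $k\in[m]$, and that $x$ falsifies the clause $C_{i,j}$ if $x_{C_{i,j}(k)}=0$ for all $k\in[m]$. Define $\Gamma(x)\in ([N]\times[N])\cup\{0^*,1^*\}$ as follows: $\Gamma(x)=0^*$ if $x$ satisfies no term; $\Gamma(x)=1^*$ if $x$ satisfies at least two terms $T_i$, $T_{i'}$ with $i\ne i'$; if $x$ satisfies exactly one term $T_i$, then $\Gamma(x)=1^*$ if $x$ falsifies no clause $C_{i,j}$, $j\in[N]$, $\Gamma(x)=0^*$ if it falsifies at least two of them (for different indices $j$), and $\Gamma(x)=(i,j)$ if it falsifies exactly one, $C_{i,j}$. Given functions $h_{i,j}:\{0,1\}^n\to\{0,1\}$, define $f:\{0,1\}^n\to\{0,1\}$ by $f(x)=1$ if $|x|>n/2+\sqrt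 n$; $f(x)=0$ if $|x|<n/2-\sqrt n$; and otherwise $f(x)=0$ if $\Gamma(x)=0^*$, $f(x)=1$ if $\Gamma(x)=1^*$, and $f(x)=h_{i,j}(x)$ if $\Gamma(x)=(i,j)$. Let $\mathcal D_{\rm yes}$ be the law of $f$ when $h_{i,j}(x)=x_{\kappa_{i,j}}$ for all $i,j$, and $\mathcal D_{\rm no}$ the law of $f$ when $h_{i,j}(x)=1-x_{\kappa_{i,j}}$ for all $i,j$. **Terminology.** $f$ is $\varepsilon$-far from monotone if every monotone $g:\{0,1\}^n\to\{0,1\}$ differs from $f$ on at least $\varepsilon 2^n$ points. A (randomized, adaptive) $q$-query algorithm is a probability distribution over binary decision trees of depth at most $q$ whose inner nodes query values $f(x)$, $x\in\{0,1\}^n$, and whose leaves accept or reject. It is an $\varepsilon$-tester for monotonicity if it accepts every monotone $f$ with probability at least $2/3$ and rejects every $f$ that is $\varepsilon$-far from monotone with probability at least $2/3$. **Theorem.** 1. For every $n\ge1$, every function in the support of $\mathcal D_{\rm yes}$ is monotone. 2. For every $\delta>0$ there is $n_0$ such that for all $n\ge n_0$, all integers $0\le q\le n^{1/3}/\log^2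 n$ and every $q$-query algorithm $A$, $$\Big|\Pr_{f\sim\mathcal D_{\rm yes}}[A\text{ accepts }f]-\Pr_{f\sim\mathcal D_{\rm no}}[A\text{ accepts }f]\Big|\le\delta ,$$ where the probabilities are also over the randomness of $A$. 3. There is a constant $\varepsilon>0$ such that (a) there are $p>0$ and $n_0$ such that for all $n\ge n_0$, a function drawn from $\mathcal D_{\rm no}$ is $\varepsilon$-far from monotone with probability at least $p$; (b) there are $c>0$ and $n_0$ such that for all $n\ge n_0$, every $q$-query $\varepsilon$-tester for monotonicity of functions $\{0,1\}^n\to\{0,1\}$ has $q\ge c\, n^{1/3}/\log^2 n$. Here $\log$ is the natural logarithm. -/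

import Mathlib

namespace MonoTesting

noncomputable section

open Classical

/-- Boolean functions on the cube `{0,1}^n`, with `true` for `1` and `false` for `0`. -/
abbrev BoolFun (n : ℕ) := (Fin n → Bool) → Bool

/-! ### Distance to monotonicity -/

/-- Fraction of the points of the cube at which `f` and `g` differ. -/
def dist {n : ℕ} (f g : BoolFun n) : ℝ :=
  ((Finset.univ.filter fun x => f x ≠ g x).card : ℝ) / 2 ^ n

/-- `f` is `ε`-far from monotone. -/
def IsFar {n : ℕ} (ε : ℝ) (f : BoolFun n) : Prop :=
  ∀ g : BoolFun n, Monotone g → ε ≤ dist f g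

/-! ### Multiplexer maps and the functions built from them -/

/-- Number of variables in each term and clause, `⌊√n⌋`. -/
abbrev width (n : ℕ) : ℕ := Nat.sqrt n

/-- The number `N = 2 ^ ⌊√n⌋` of terms (and of clauses below each term). -/
abbrev numTerms (n : ℕ) : ℕ := 2 ^ width n

/-- Sequences `T = (T_i)` of terms, each given by its sequence of variables. -/
abbrev Terms (n : ℕ) := Fin (numTerms n) → Fin (width n) → Fin n

/-- Families `C = (C_{i,j})` of clauses, each given by its sequence of variables. -/
abbrev Clauses (n : ℕ) := Fin (numTerms n) → Fin (numTerms n) → Fin (width n) → Fin n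

/-- Families `H = (h_{i,j})` of Boolean functions. -/
abbrev Bottoms (n : ℕ) := Fin (numTerms n) → Fin (numTerms n) → BoolFun n

/-- `x` satisfies the term (conjunction) of the variables `t`. -/
def TermSat {n : ℕ} (t : Fin (width n) → Fin n) (x : Fin n → Bool) : Prop :=
  ∀ k, x (t k) = true

/-- `x` satisfies the clause (disjunction) of the variables `c`. -/
def ClauseSat {n : ℕ} (c : Fin (width n) → Fin n) (x : Fin n → Bool) : Prop :=
  ∃ k, x (c k) = true

/-- Values of a multiplexer map: `0*`, `1*`, or a pair of indices. -/
inductive MuxVal (N : ℕ) : Type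
  | zeroStar : MuxVal N
  | oneStar : MuxVal N
  | pair (i j : Fin N) : MuxVal N

/-- The multiplexer map `Γ_{T,C}`. -/
def mux {n : ℕ} (T : Terms n) (C : Clauses n) (x : Fin n → Bool) : MuxVal (numTerms n) :=
  if ∀ i, ¬ TermSat (T i) x then .zeroStar
  else if h : ∃! i, TermSat (T i) x then
    if ∀ j, ClauseSat (C h.choose j) x then .oneStar
    else if h' : ∃! j, ¬ ClauseSat (C h.choose j) x then .pair h.choose h'.choose
    else .zeroStar
  else .oneStar

/-- Hamming weight. -/
def weight {n : ℕ} (x : Fin n → Bool) : ℕ := (Finset.univ.filter fun k => x k = true).card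

/-- The function `f_{T,C,H}`. -/
def muxFun {n : ℕ} (T : Terms n) (C : Clauses n) (H : Bottoms n) : BoolFun n := fun x =>
  if (n : ℝ) / 2 + √(n : ℝ) < (weight x : ℝ) then true
  else if (weight x : ℝ) < (n : ℝ) / 2 - √(n : ℝ) then false
  else match mux T C x with
    | .zeroStar => false
    | .oneStar => true
    | .pair i j => H i j x

/-! ### The two distributions -/

/-- Uniformly random terms and clauses. -/
def distE (n : ℕ) [NeZero n] : PMF (Terms n × Clauses n) :=
  PMF.uniformOfFintype (Terms n × Clauses n)

/-- Independent uniformly random dictators `x ↦ x_k`. -/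
def distEYes (n : ℕ) [NeZero n] : PMF (Bottoms n) :=
  (PMF.uniformOfFintype (Fin (numTerms n) → Fin (numTerms n) → Fin n)).map
    fun κ i j x => x (κ i j)

/-- Independent uniformly random anti-dictators `x ↦ ¬ x_k`. -/
def distENo (n : ℕ) [NeZero n] : PMF (Bottoms n) :=
  (PMF.uniformOfFintype (Fin (numTerms n) → Fin (numTerms n) → Fin n)).map
    fun κ i j x => !(x (κ i j))

/-- The law of `f_{T,C,H}` for independent `(T, C) ∼ distE` and dictators `H`. -/
def distYes (n : ℕ) [NeZero n] : PMF (BoolFun n) :=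
  (distE n).bind fun TC => (distEYes n).map fun H => muxFun TC.1 TC.2 H

/-- The law of `f_{T,C,H}` for independent `(T, C) ∼ distE` and anti-dictators `H`. -/
def distNo (n : ℕ) [NeZero n] : PMF (BoolFun n) :=
  (distE n).bind fun TC => (distENo n).map fun H => muxFun TC.1 TC.2 H

/-- Probability of an event, as a real number. -/
def prob {α : Type} (p : PMF α) (S : Set α) : ℝ := (p.toOuterMeasure S).toReal

/-! ### Adaptive query algorithms -/

/-- Deterministic adaptive query algorithms: a leaf accepts (`true`) or rejects (`false`); an
inner node queries a point and continues according to the answer. -/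
inductive QueryTree (n : ℕ) : Type
  | leaf (verdict : Bool) : QueryTree n
  | query (x : Fin n → Bool) (onZero onOne : QueryTree n) : QueryTree n

/-- Largest number of queries on a path. -/
def QueryTree.depth {n : ℕ} : QueryTree n → ℕ
  | .leaf _ => 0
  | .query _ t₀ t₁ => max t₀.depth t₁.depth + 1

/-- Verdict of the algorithm with oracle `f`. -/
def QueryTree.run {n : ℕ} (f : BoolFun n) : QueryTree n → Bool
  | .leaf b => b
  | .query x t₀ t₁ => if f x = true then t₁.run f else t₀.run f

/-- Randomized adaptive algorithms: a random deterministic one. -/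
abbrev RandAlg (n : ℕ) := PMF (QueryTree n)

/-- The algorithm never makes more than `q` queries. -/
def RandAlg.MakesAtMost {n : ℕ} (A : RandAlg n) (q : ℕ) : Prop :=
  ∀ t ∈ A.support, t.depth ≤ q

/-- The random verdict of `A` on the oracle `f`. -/
def RandAlg.output {n : ℕ} (A : RandAlg n) (f : BoolFun n) : PMF Bool :=
  PMF.map (fun t => t.run f) A

/-- The random verdict of `A` on an oracle drawn from `D`, independently of the coins of `A`. -/
def RandAlg.outputOn {n : ℕ} (A : RandAlg n) (D : PMF (BoolFun n)) : PMF Bool :=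
  D.bind fun f => A.output f

/-- `A` is a (two-sided error) tester of monotonicity with distance parameter `ε`. -/
def RandAlg.IsMonotonicityTester {n : ℕ} (A : RandAlg n) (ε : ℝ) : Prop :=
  (∀ f : BoolFun n, Monotone f → 2 / 3 ≤ prob (A.output f) {true}) ∧
  (∀ f : BoolFun n, IsFar ε f → 2 / 3 ≤ prob (A.output f) {false})

end

end MonoTesting

/-! Monotonicity: going up the cube, satisfied terms accumulate and falsified clauses disappear, so
the multiplexer can only pass from `0*` through a fixed pair to `1*`. Dictators at the pairs keep
this monotone.

Indistinguishability: both laws are compared with a third one, `coinFun`, whose bottoms are random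
constants, and it suffices to treat one decision tree (`prob_outputOn_le`). Fix the terms and
clauses. A transcript of the constant model forces one bit, of probability 1/2, at each pair it
selects. A dictator or anti-dictator gives the same answers if its variable lies in the set of
coordinates on which all queries active at that pair share the required value (`core`). If every
core has size nearly n/2, the likelihood ratio is at least 1 - o(1) (`freq_transcript_ge`).

Cores stay large unless some query jumps, that is, spoils more than D coordinates of the core of a
term or clause already active. Jumps are rare (`card_jump_mul_le`): a term whose variables avoid the
spoiled coordinates could have had most of its variables there instead, with the same transcript so
far, so avoidance costs a factor (1 + D/n)^(m - q). Without jumps, a clause active at P queries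
loses at most 4D√q·P coordinates from n/2 (`card_core_activeClause_ge`). As the P's sum to at most
2q, the total error is of order D·q^(3/2)/n. With D = √n·log² n this is small exactly in the range q
≤ n^(1/3)/log² n.

Distance: under anti-dictators, an edge in direction κ_{i,j} with both ends in the middle layers and
sent to (i,j) is violated. Such edges are disjoint, so their density bounds the distance to every
monotone function (`freq_violating_le_dist`). A balanced point is the lower end of one with constant
probability (`le_freq_violating`), and reverse Markov gives distance bounded below with constant
probability.

Testers: a constant number of majority votes makes the error small compared with p, and the tester
would then tell the two laws apart (`tester_lower_bound`). -/

namespace MonoTesting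

noncomputable section

open Classical

/-! ### Finite uniform probabilities -/

/-- Fraction of the elements of a finite type that satisfy `P`. -/
def freq {α : Type} [Fintype α] (P : α → Prop) : ℝ :=
  ((Finset.univ.filter P).card : ℝ) / Fintype.card α

theorem freq_nonneg {α : Type} [Fintype α] (P : α → Prop) : 0 ≤ freq P := by
  unfold freq; positivity

theorem freq_mono {α : Type} [Fintype α] {P Q : α → Prop} (h : ∀ a, P a → Q a) :
    freq P ≤ freq Q := by
  unfold freq
  gcongr with a
  exact h a

theorem freq_or_le {α : Type} [Fintype α] (P Q : α → Prop) :
    freq (fun a => P a ∨ Q a) ≤ freq P + freq Q := by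
  unfold freq
  rw [← add_div]
  gcongr
  have : (Finset.univ.filter P ∪ Finset.univ.filter Q).card ≤ _ := Finset.card_union_le _ _
  refine le_trans (Nat.cast_le.2 (Finset.card_le_card fun a => ?_)) (by exact_mod_cast this)
  simp

theorem freq_exists_le {α ι : Type} [Fintype α] (s : Finset ι) (P : ι → α → Prop) :
    freq (fun a => ∃ i ∈ s, P i a) ≤ ∑ i ∈ s, freq (P i) := by
  induction s using Finset.induction_on with
  | empty => simp [freq]
  | insert i s hi ih =>
    rw [Finset.sum_insert hi]
    refine le_trans (freq_mono ?_) ((freq_or_le (P i) _).trans (add_le_add_right ih _))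
    intro a
    simp

theorem freq_add_not {α : Type} [Fintype α] [Nonempty α] (P : α → Prop) :
    freq P + freq (fun a => ¬ P a) = 1 := by
  unfold freq
  rw [← add_div, ← Nat.cast_add, Finset.card_filter_add_card_filter_not, Finset.card_univ]
  exact div_self (by exact_mod_cast Fintype.card_ne_zero)

theorem freq_eq_sum {α : Type} [Fintype α] (P : α → Prop) :
    freq P = (∑ a, if P a then (1 : ℝ) else 0) / Fintype.card α := by
  unfold freq
  rw [Finset.sum_boole]

theorem freq_prod {α β : Type} [Fintype α] [Fintype β] (P : α × β → Prop) :
    freq P = (∑ a, freq fun b => P (a, b)) / Fintype.card α := by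
  simp only [freq_eq_sum, Fintype.card_prod, Fintype.sum_prod_type, ← Finset.sum_div]
  push_cast
  rw [div_div, mul_comm]

/-! ### Reduction of the two laws to finite counting -/

/-- Choices of the variable of each (anti-)dictator. -/
abbrev Dicts (n : ℕ) := Fin (numTerms n) → Fin (numTerms n) → Fin n

theorem prob_bind_uniform {α β γ δ : Type} [Fintype α] [Nonempty α] [Fintype β] [Nonempty β]
    (h : β → γ) (F : α → γ → δ) (S : Set δ) :
    prob ((PMF.uniformOfFintype α).bind fun a => ((PMF.uniformOfFintype β).map h).map (F a)) S
      = freq fun p : α × β => F p.1 (h p.2) ∈ S := by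
  unfold prob
  rw [PMF.toOuterMeasure_bind_apply, tsum_fintype, freq_prod, ENNReal.toReal_sum, Finset.sum_div]
  · refine Finset.sum_congr rfl fun a _ => ?_
    rw [PMF.map_comp, PMF.toOuterMeasure_map_apply, PMF.toOuterMeasure_uniformOfFintype_apply,
      PMF.uniformOfFintype_apply, ENNReal.toReal_mul, ENNReal.toReal_div, freq]
    simp only [ENNReal.toReal_inv, ENNReal.toReal_natCast]
    rw [div_eq_inv_mul, Fintype.card_subtype]
    simp only [Set.mem_preimage, Function.comp_apply]
    ring
  · intro a _
    refine ENNReal.mul_ne_top (by simp) ?_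
    rw [PMF.toOuterMeasure_apply]
    exact PMF.tsum_coe_indicator_ne_top _ _

theorem prob_distYes (n : ℕ) [NeZero n] (S : Set (BoolFun n)) :
    prob (distYes n) S = freq fun p : (Terms n × Clauses n) × Dicts n =>
      muxFun p.1.1 p.1.2 (fun i j x => x (p.2 i j)) ∈ S := by
  unfold distYes distEYes distE
  exact prob_bind_uniform (α := Terms n × Clauses n) (β := Dicts n) (γ := Bottoms n)
    (fun κ i j x => x (κ i j)) (fun TC H => muxFun TC.1 TC.2 H) S

theorem prob_distNo (n : ℕ) [NeZero n] (S : Set (BoolFun n)) :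
    prob (distNo n) S = freq fun p : (Terms n × Clauses n) × Dicts n =>
      muxFun p.1.1 p.1.2 (fun i j x => !(x (p.2 i j))) ∈ S := by
  unfold distNo distENo distE
  exact prob_bind_uniform (α := Terms n × Clauses n) (β := Dicts n) (γ := Bottoms n)
    (fun κ i j x => !(x (κ i j))) (fun TC H => muxFun TC.1 TC.2 H) S

/-! ### Averaging over the coins of an algorithm -/

theorem outputOn_apply {n : ℕ} (A : RandAlg n) (D : PMF (BoolFun n)) :
    (A.outputOn D).toOuterMeasure {true} =
      ∑' t, A t * D.toOuterMeasure {f | t.run f = true} := by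
  have : A.outputOn D = A.bind fun t => D.map fun f => t.run f := by
    unfold RandAlg.outputOn RandAlg.output
    simp only [PMF.map]
    exact PMF.bind_comm D A _
  rw [this, PMF.toOuterMeasure_bind_apply]
  simp only [PMF.toOuterMeasure_map_apply]
  rfl

/-- The easy direction of Yao's principle: the coins are independent of the oracle, so the tree can
be drawn first, and a bound for each tree in the support survives averaging. It is one-sided and
gets applied in both directions. -/
theorem prob_outputOn_le {n : ℕ} (A : RandAlg n) (D D' : PMF (BoolFun n)) {δ : ℝ} (hδ : 0 ≤ δ)
    (h : ∀ t ∈ A.support, prob D {f | t.run f = true} ≤ prob D' {f | t.run f = true} + δ) :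
    prob (A.outputOn D) {true} ≤ prob (A.outputOn D') {true} + δ := by
  have fin : ∀ {α : Type} (p : PMF α) (S : Set α), p.toOuterMeasure S ≠ ⊤ := fun p S => by
    rw [PMF.toOuterMeasure_apply]
    exact PMF.tsum_coe_indicator_ne_top _ _
  have key : (A.outputOn D).toOuterMeasure {true} ≤
      (A.outputOn D').toOuterMeasure {true} + ENNReal.ofReal δ := by
    rw [outputOn_apply, outputOn_apply]
    calc ∑' t, A t * D.toOuterMeasure {f | t.run f = true}
        ≤ ∑' t, (A t * D'.toOuterMeasure {f | t.run f = true} + A t * ENNReal.ofReal δ) := by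
          refine ENNReal.tsum_le_tsum fun t => ?_
          by_cases ht : A t = 0
          · simp [ht]
          · rw [← mul_add]
            gcongr
            have := h t ((PMF.mem_support_iff _ _).2 ht)
            unfold prob at this
            rw [← ENNReal.ofReal_toReal (fin D _), ← ENNReal.ofReal_toReal (fin D' _),
              ← ENNReal.ofReal_add ENNReal.toReal_nonneg hδ]
            exact ENNReal.ofReal_le_ofReal this
      _ = _ := by
          rw [ENNReal.tsum_add, ENNReal.tsum_mul_right, PMF.tsum_coe, one_mul]
  unfold prob
  have := ENNReal.toReal_mono (ENNReal.add_ne_top.2 ⟨fin _ _, ENNReal.ofReal_ne_top⟩) key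
  rwa [ENNReal.toReal_add (fin _ _) ENNReal.ofReal_ne_top, ENNReal.toReal_ofReal hδ] at this

/-! ### Evaluation of the multiplexer -/

theorem mux_none {n : ℕ} {T : Terms n} {C : Clauses n} {x : Fin n → Bool}
    (h : ∀ i, ¬ TermSat (T i) x) : mux T C x = .zeroStar := by
  simp [mux, h]

theorem mux_two_terms {n : ℕ} {T : Terms n} {C : Clauses n} {x : Fin n → Bool}
    {i i' : Fin (numTerms n)} (hi : TermSat (T i) x) (hi' : TermSat (T i') x) (hne : i ≠ i') :
    mux T C x = .oneStar := by
  unfold mux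
  rw [if_neg (fun h => h i hi), dif_neg]
  rintro ⟨a, -, ha⟩
  exact hne ((ha i hi).trans (ha i' hi').symm)

theorem mux_unique {n : ℕ} {T : Terms n} {C : Clauses n} {x : Fin n → Bool}
    {i : Fin (numTerms n)} (hi : TermSat (T i) x) (hu : ∀ i', TermSat (T i') x → i' = i) :
    mux T C x = if ∀ j, ClauseSat (C i j) x then .oneStar
      else if h' : ∃! j, ¬ ClauseSat (C i j) x then .pair i h'.choose else .zeroStar := by
  unfold mux
  have h : ∃! i, TermSat (T i) x := ⟨i, hi, hu⟩
  rw [if_neg (fun h => h i hi), dif_pos h]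
  have : h.choose = i := hu _ h.choose_spec.1
  simp only [this]

theorem mux_no_clause {n : ℕ} {T : Terms n} {C : Clauses n} {x : Fin n → Bool}
    {i : Fin (numTerms n)} (hi : TermSat (T i) x) (hu : ∀ i', TermSat (T i') x → i' = i)
    (hc : ∀ j, ClauseSat (C i j) x) : mux T C x = .oneStar := by
  rw [mux_unique hi hu, if_pos hc]

theorem mux_pair {n : ℕ} {T : Terms n} {C : Clauses n} {x : Fin n → Bool}
    {i j : Fin (numTerms n)} (hi : TermSat (T i) x) (hu : ∀ i', TermSat (T i') x → i' = i)
    (hj : ¬ ClauseSat (C i j) x) (hv : ∀ j', ¬ ClauseSat (C i j') x → j' = j) :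
    mux T C x = .pair i j := by
  have h : ∃! j, ¬ ClauseSat (C i j) x := ⟨j, hj, hv⟩
  rw [mux_unique hi hu, if_neg (fun h => hj (h j)), dif_pos h, hv _ h.choose_spec.1]

theorem mux_two_clauses {n : ℕ} {T : Terms n} {C : Clauses n} {x : Fin n → Bool}
    {i j j' : Fin (numTerms n)} (hi : TermSat (T i) x) (hu : ∀ i', TermSat (T i') x → i' = i)
    (hj : ¬ ClauseSat (C i j) x) (hj' : ¬ ClauseSat (C i j') x) (hne : j ≠ j') :
    mux T C x = .zeroStar := by
  rw [mux_unique hi hu, if_neg (fun h => hj (h j)), dif_neg]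
  rintro ⟨a, -, ha⟩
  exact hne ((ha j hj).trans (ha j' hj').symm)

theorem mux_eq_pair_iff {n : ℕ} {T : Terms n} {C : Clauses n} {x : Fin n → Bool}
    {i j : Fin (numTerms n)} : mux T C x = .pair i j ↔
      (TermSat (T i) x ∧ ∀ i', TermSat (T i') x → i' = i) ∧
        ¬ ClauseSat (C i j) x ∧ ∀ j', ¬ ClauseSat (C i j') x → j' = j := by
  refine ⟨fun h => ?_, fun h => mux_pair h.1.1 h.1.2 h.2.1 h.2.2⟩
  by_cases h0 : ∀ i, ¬ TermSat (T i) x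
  · rw [mux_none h0] at h; cases h
  push Not at h0
  obtain ⟨a, ha⟩ := h0
  by_cases h1 : ∀ i', TermSat (T i') x → i' = a
  · by_cases h2 : ∀ j, ClauseSat (C a j) x
    · rw [mux_no_clause ha h1 h2] at h; cases h
    push Not at h2
    obtain ⟨b, hb⟩ := h2
    by_cases h3 : ∀ j', ¬ ClauseSat (C a j') x → j' = b
    · rw [mux_pair ha h1 hb h3] at h
      injection h with e1 e2
      subst e1 e2
      exact ⟨⟨ha, h1⟩, hb, h3⟩
    · push Not at h3
      obtain ⟨b', hb', hne⟩ := h3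
      rw [mux_two_clauses ha h1 hb' hb hne] at h; cases h
  · push Not at h1
    obtain ⟨a', ha', hne⟩ := h1
    rw [mux_two_terms ha' ha hne] at h; cases h

/-! ### Monotonicity of the functions built from monotone bottoms -/

theorem TermSat.mono {n : ℕ} {t : Fin (width n) → Fin n} {x y : Fin n → Bool} (hxy : x ≤ y)
    (h : TermSat t x) : TermSat t y := fun k => by
  have := hxy (t k)
  rw [h k] at this
  exact top_le_iff.1 this

theorem ClauseSat.mono {n : ℕ} {c : Fin (width n) → Fin n} {x y : Fin n → Bool} (hxy : x ≤ y)
    (h : ClauseSat c x) : ClauseSat c y := by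
  obtain ⟨k, hk⟩ := h
  refine ⟨k, ?_⟩
  have := hxy (c k)
  rw [hk] at this
  exact top_le_iff.1 this

theorem weight_mono {n : ℕ} {x y : Fin n → Bool} (hxy : x ≤ y) : weight x ≤ weight y := by
  refine Finset.card_le_card fun k hk => ?_
  simp only [Finset.mem_filter, Finset.mem_univ, true_and] at hk ⊢
  have := hxy k
  rw [hk] at this
  exact top_le_iff.1 this

/-- The value selected by the multiplexer. -/
def muxVal {n : ℕ} (H : Bottoms n) (x : Fin n → Bool) : MuxVal (numTerms n) → Bool
  | .zeroStar => false
  | .oneStar => true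
  | .pair i j => H i j x

theorem muxFun_eq {n : ℕ} (T : Terms n) (C : Clauses n) (H : Bottoms n) (x : Fin n → Bool) :
    muxFun T C H x = if (n : ℝ) / 2 + √(n : ℝ) < (weight x : ℝ) then true
      else if (weight x : ℝ) < (n : ℝ) / 2 - √(n : ℝ) then false
      else muxVal H x (mux T C x) := by
  unfold muxFun muxVal
  split_ifs <;> rfl

/-- Either `x` has value 0 (no term, or two falsified clauses), or `y` has value 1 (two terms, or no
falsified clause), or both points select the same pair, where `H i j` is monotone. -/
theorem muxVal_mono {n : ℕ} (T : Terms n) (C : Clauses n) {H : Bottoms n}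
    (hH : ∀ i j, Monotone (H i j)) {x y : Fin n → Bool} (hxy : x ≤ y) :
    muxVal H x (mux T C x) ≤ muxVal H y (mux T C y) := by
  by_cases h0 : ∀ i, ¬ TermSat (T i) x
  · rw [mux_none h0]; exact Bool.false_le _
  push Not at h0
  obtain ⟨i, hi⟩ := h0
  by_cases h1 : ∀ i', TermSat (T i') y → i' = i
  · have h1x : ∀ i', TermSat (T i') x → i' = i := fun i' h => h1 i' (h.mono hxy)
    by_cases h2 : ∀ j, ClauseSat (C i j) y
    · rw [mux_no_clause (hi.mono hxy) h1 h2]; exact Bool.le_true _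
    push Not at h2
    obtain ⟨j, hj⟩ := h2
    have hjx : ¬ ClauseSat (C i j) x := fun h => hj (h.mono hxy)
    by_cases h3 : ∀ j', ¬ ClauseSat (C i j') x → j' = j
    · rw [mux_pair (hi.mono hxy) h1 hj (fun j' h => h3 j' fun h' => h (h'.mono hxy)),
        mux_pair hi h1x hjx h3]
      exact hH i j hxy
    · push Not at h3
      obtain ⟨j', hj', hne⟩ := h3
      rw [mux_two_clauses hi h1x hj' hjx hne]; exact Bool.false_le _
  · push Not at h1
    obtain ⟨i', hi', hne⟩ := h1
    rw [mux_two_terms hi' (hi.mono hxy) hne]; exact Bool.le_true _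

theorem monotone_muxFun {n : ℕ} (T : Terms n) (C : Clauses n) {H : Bottoms n}
    (hH : ∀ i j, Monotone (H i j)) : Monotone (muxFun T C H) := by
  intro x y hxy
  have hw : (weight x : ℝ) ≤ weight y := by exact_mod_cast weight_mono hxy
  rw [muxFun_eq, muxFun_eq]
  split_ifs <;> first | exact Bool.false_le _ | exact Bool.le_true _ | skip
  · linarith
  · linarith
  · linarith
  · exact muxVal_mono T C hH hxy

theorem monotone_of_mem_support_distYes (n : ℕ) [NeZero n] (f : BoolFun n)
    (hf : f ∈ (distYes n).support) : Monotone f := by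
  unfold distYes distEYes at hf
  simp only [PMF.mem_support_bind_iff, PMF.mem_support_map_iff] at hf
  obtain ⟨TC, -, H, ⟨κ, -, rfl⟩, rfl⟩ := hf
  exact monotone_muxFun _ _ fun i j x y hxy => hxy (κ i j)

/-! ### Amplification by repeated majority votes -/

/-- Run `t` and continue according to its verdict. -/
def QueryTree.andThen {n : ℕ} : QueryTree n → (Bool → QueryTree n) → QueryTree n
  | .leaf b, k => k b
  | .query x t₀ t₁, k => .query x (t₀.andThen k) (t₁.andThen k)

theorem QueryTree.run_andThen {n : ℕ} (f : BoolFun n) (t : QueryTree n) (k : Bool → QueryTree n) :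
    (t.andThen k).run f = (k (t.run f)).run f := by
  induction t with
  | leaf b => rfl
  | query x t₀ t₁ h₀ h₁ =>
    simp only [andThen, run]
    split_ifs <;> assumption

theorem QueryTree.depth_andThen_le {n : ℕ} (t : QueryTree n) (k : Bool → QueryTree n) {d : ℕ}
    (hk : ∀ b, (k b).depth ≤ d) : (t.andThen k).depth ≤ t.depth + d := by
  induction t with
  | leaf b => simpa [andThen, depth] using hk b
  | query x t₀ t₁ h₀ h₁ =>
    simp only [andThen, depth]
    omega

/-- Majority of three bits. -/
def majority (a b c : Bool) : Bool := (a && b) || (b && c) || (a && c)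

/-- Run three algorithms and take the majority of their verdicts. -/
def QueryTree.vote {n : ℕ} (t t' t'' : QueryTree n) : QueryTree n :=
  t.andThen fun a => t'.andThen fun b => t''.andThen fun c => .leaf (majority a b c)

theorem QueryTree.run_vote {n : ℕ} (f : BoolFun n) (t t' t'' : QueryTree n) :
    (t.vote t' t'').run f = majority (t.run f) (t'.run f) (t''.run f) := by
  simp only [vote, run_andThen, run]

theorem QueryTree.depth_vote_le {n : ℕ} {t t' t'' : QueryTree n} {q : ℕ} (h : t.depth ≤ q)
    (h' : t'.depth ≤ q) (h'' : t''.depth ≤ q) : (t.vote t' t'').depth ≤ 3 * q := by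
  have h1 : ∀ a b, (t''.andThen fun c => QueryTree.leaf (majority a b c)).depth ≤ q := fun a b =>
    (depth_andThen_le (d := 0) _ _ fun c => le_rfl).trans h''
  have h2 : ∀ a, (t'.andThen fun b => t''.andThen fun c =>
      QueryTree.leaf (majority a b c)).depth ≤ q + q := fun a =>
    (depth_andThen_le _ _ (h1 a)).trans (by omega)
  exact (depth_andThen_le _ _ h2).trans (by omega)

/-- Three independent runs of `A`, followed by a majority vote. -/
def RandAlg.vote {n : ℕ} (A : RandAlg n) : RandAlg n :=
  PMF.bind A fun t => PMF.bind A fun t' => PMF.map (fun t'' => t.vote t' t'') A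

theorem RandAlg.MakesAtMost.vote {n : ℕ} {A : RandAlg n} {q : ℕ} (h : A.MakesAtMost q) :
    A.vote.MakesAtMost (3 * q) := by
  intro t ht
  simp only [RandAlg.vote, PMF.mem_support_bind_iff, PMF.mem_support_map_iff] at ht
  obtain ⟨t₁, h₁, t₂, h₂, t₃, h₃, rfl⟩ := ht
  exact QueryTree.depth_vote_le (h _ h₁) (h _ h₂) (h _ h₃)

theorem RandAlg.output_vote {n : ℕ} (A : RandAlg n) (f : BoolFun n) :
    A.vote.output f = (A.output f).bind fun a => (A.output f).bind fun b =>
      (A.output f).map (majority a b) := by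
  simp only [RandAlg.output, RandAlg.vote, PMF.map_bind, PMF.map_comp, PMF.bind_map]
  congr 1; funext t; simp only [Function.comp_apply]
  congr 1; funext t'; simp only [Function.comp_apply]
  congr 1; funext t''
  exact QueryTree.run_vote _ _ _ _

theorem prob_singleton {α : Type} (P : PMF α) (a : α) : prob P {a} = (P a).toReal := by
  rw [prob, PMF.toOuterMeasure_apply_singleton]

theorem prob_true_add_prob_false (P : PMF Bool) : prob P {true} + prob P {false} = 1 := by
  rw [prob_singleton, prob_singleton, ← ENNReal.toReal_add (P.apply_ne_top _) (P.apply_ne_top _),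
    add_comm, ← tsum_bool, P.tsum_coe, ENNReal.toReal_one]

theorem prob_majority (P : PMF Bool) (v : Bool) :
    prob (P.bind fun a => P.bind fun b => P.map (majority a b)) {v} =
      prob P {v} ^ 3 + 3 * prob P {v} ^ 2 * prob P {!v} := by
  have ht := P.apply_ne_top true
  have hf := P.apply_ne_top false
  simp only [prob_singleton, PMF.bind_apply, PMF.map_apply, tsum_bool]
  cases v <;> simp [majority] <;>
    rw [ENNReal.toReal_add] <;>
    simp only [ENNReal.toReal_add, ENNReal.toReal_mul, ht, hf, ne_eq, not_false_eq_true,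
      ENNReal.mul_eq_top, ENNReal.add_eq_top, and_false, false_and, or_self] <;> ring

/-- `A` tells monotone functions from those `ε`-far from monotone with error at most `e`. -/
def RandAlg.Separates {n : ℕ} (A : RandAlg n) (ε e : ℝ) : Prop :=
  (∀ f : BoolFun n, Monotone f → 1 - e ≤ prob (A.output f) {true}) ∧
  (∀ f : BoolFun n, IsFar ε f → 1 - e ≤ prob (A.output f) {false})

/-- The majority errs with probability b(3b - 2b²), and 3b - 2b² is at most its value 7/9 at b =
1/3. -/
theorem majority_error {a b e : ℝ} (hab : a + b = 1) (hb : 0 ≤ b) (he : e ≤ 1 / 3)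
    (ha : 1 - e ≤ a) : 1 - 7 / 9 * e ≤ a ^ 3 + 3 * a ^ 2 * b := by
  obtain rfl : a = 1 - b := by linarith
  have hbe : b ≤ e := by linarith
  have h1 : b * (3 * b - 2 * b ^ 2) ≤ b * (7 / 9) :=
    mul_le_mul_of_nonneg_left (by nlinarith) hb
  nlinarith

theorem RandAlg.Separates.vote {n : ℕ} {A : RandAlg n} {ε e : ℝ} (he : e ≤ 1 / 3)
    (h : A.Separates ε e) : A.vote.Separates ε (7 / 9 * e) := by
  refine ⟨fun f hf => ?_, fun f hf => ?_⟩ <;> rw [RandAlg.output_vote, prob_majority]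
  · exact majority_error (prob_true_add_prob_false _) ENNReal.toReal_nonneg he (h.1 f hf)
  · exact majority_error ((add_comm _ _).trans (prob_true_add_prob_false _))
      ENNReal.toReal_nonneg he (h.2 f hf)

/-- Error 1/3 is too large for the lower bound, since the far functions may have only a small mass
p. Each round of voting triples the queries and shrinks the error geometrically. -/
theorem RandAlg.IsMonotonicityTester.exists_separates {n : ℕ} {A : RandAlg n} {ε : ℝ} {q : ℕ}
    (h : A.IsMonotonicityTester ε) (hq : A.MakesAtMost q) (r : ℕ) :
    ∃ B : RandAlg n, B.MakesAtMost (3 ^ r * q) ∧ B.Separates ε ((7 / 9) ^ r * (1 / 3)) := by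
  induction r with
  | zero =>
    refine ⟨A, by simpa using hq, ?_⟩
    unfold RandAlg.Separates
    norm_num
    exact h
  | succ r ih =>
    obtain ⟨B, hB, hs⟩ := ih
    refine ⟨B.vote, ?_, ?_⟩
    · have := hB.vote
      rwa [← mul_assoc, ← pow_succ'] at this
    · have := hs.vote (mul_le_of_le_one_left (by norm_num)
        (pow_le_one₀ (by norm_num) (by norm_num)))
      rwa [← mul_assoc, ← pow_succ'] at this

theorem prob_outputOn {n : ℕ} (A : RandAlg n) (D : PMF (BoolFun n)) (v : Bool) :
    prob (A.outputOn D) {v} = ∑ f, (D f).toReal * prob (A.output f) {v} := by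
  simp only [prob_singleton, RandAlg.outputOn, PMF.bind_apply, tsum_fintype]
  rw [ENNReal.toReal_sum fun f _ => ENNReal.mul_ne_top (D.apply_ne_top _) (PMF.apply_ne_top _ _)]
  simp only [ENNReal.toReal_mul]

theorem le_prob_outputOn {n : ℕ} (A : RandAlg n) (D : PMF (BoolFun n)) (v : Bool)
    (S : Set (BoolFun n)) {a : ℝ} (h : ∀ f ∈ S, a ≤ prob (A.output f) {v}) :
    a * prob D S ≤ prob (A.outputOn D) {v} := by
  rw [prob_outputOn, prob, PMF.toOuterMeasure_apply_fintype, ENNReal.toReal_sum, Finset.mul_sum]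
  · refine Finset.sum_le_sum fun f _ => ?_
    by_cases hf : f ∈ S
    · rw [Set.indicator_of_mem hf, mul_comm]
      exact mul_le_mul_of_nonneg_left (h f hf) ENNReal.toReal_nonneg
    · rw [Set.indicator_of_notMem hf]
      simp only [ENNReal.toReal_zero, mul_zero]
      exact mul_nonneg ENNReal.toReal_nonneg ENNReal.toReal_nonneg
  · intro f _
    by_cases hf : f ∈ S
    · rw [Set.indicator_of_mem hf]; exact D.apply_ne_top _
    · rw [Set.indicator_of_notMem hf]; simp

/-- Indistinguishability of the two laws implies the lower bound for testers. -/
theorem tester_lower_bound {ε p : ℝ} (hp : 0 < p)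
    (hind : ∃ n₀ : ℕ, ∀ (n : ℕ) [NeZero n], n₀ ≤ n →
      ∀ q : ℕ, (q : ℝ) ≤ (n : ℝ) ^ (1 / 3 : ℝ) / Real.log (n : ℝ) ^ 2 →
      ∀ A : RandAlg n, A.MakesAtMost q →
        |prob (A.outputOn (distYes n)) {true} - prob (A.outputOn (distNo n)) {true}| ≤ p / 2)
    (hfar : ∃ n₀ : ℕ, ∀ (n : ℕ) [NeZero n], n₀ ≤ n → p ≤ prob (distNo n) {f | IsFar ε f}) :
    ∃ c : ℝ, 0 < c ∧ ∃ n₀ : ℕ, ∀ n : ℕ, n₀ ≤ n →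
        ∀ (q : ℕ) (A : RandAlg n), A.MakesAtMost q → A.IsMonotonicityTester ε →
          c * ((n : ℝ) ^ (1 / 3 : ℝ) / Real.log (n : ℝ) ^ 2) ≤ (q : ℝ) := by
  obtain ⟨n₁, h₁⟩ := hind
  obtain ⟨n₂, h₂⟩ := hfar
  -- With error e ≤ p/8 the acceptance gap is at least (1 - e)p - e ≥ p - 2e ≥ 3p/4, contradicting
  -- the bound p/2. The number r of rounds depends on p alone, hence the constant 1/3^r.
  obtain ⟨r, hr⟩ := exists_pow_lt_of_lt_one (show 0 < p / 8 by positivity)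
    (show (7 / 9 : ℝ) < 1 by norm_num)
  refine ⟨1 / 3 ^ r, by positivity, max (max n₁ n₂) 1, fun n hn q A hq hA => ?_⟩
  have : NeZero n := ⟨by omega⟩
  by_contra hlt
  push Not at hlt
  obtain ⟨B, hB, hs⟩ := hA.exists_separates hq r
  have hd := h₁ n (by omega) (3 ^ r * q) (by
    push_cast
    rw [div_mul_eq_mul_div, one_mul, lt_div_iff₀ (by positivity)] at hlt
    linarith) B hB
  have hpf := h₂ n (by omega)
  have he : (7 / 9 : ℝ) ^ r * (1 / 3) ≤ p / 8 := by linarith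
  set e : ℝ := (7 / 9) ^ r * (1 / 3)
  have he1 : e ≤ 1 / 3 := mul_le_of_le_one_left (by norm_num)
        (pow_le_one₀ (by norm_num) (by norm_num))
  have hy : 1 - e ≤ prob (B.outputOn (distYes n)) {true} := by
    have := le_prob_outputOn B (distYes n) true (distYes n).support fun f hf =>
      hs.1 f (monotone_of_mem_support_distYes n f hf)
    have h1 : prob (distYes n) (distYes n).support = 1 := by
      rw [prob, (PMF.toOuterMeasure_apply_eq_one_iff _ _).2 subset_rfl, ENNReal.toReal_one]
    rwa [h1, mul_one] at this
  have hno := le_prob_outputOn B (distNo n) false {f | IsFar ε f} fun f hf => hs.2 f hf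
  have hsum := prob_true_add_prob_false (B.outputOn (distNo n))
  have hmul : (1 - e) * p ≤ (1 - e) * prob (distNo n) {f | IsFar ε f} :=
    mul_le_mul_of_nonneg_left hpf (by linarith)
  have hp1 : prob (distNo n) {f | IsFar ε f} ≤ 1 := by
    rw [prob_distNo]
    refine div_le_one_of_le₀ ?_ (by positivity)
    exact_mod_cast Finset.card_le_univ _
  have := (abs_le.1 hd).2
  have he0 : 0 ≤ e := by positivity
  nlinarith

/-! ### The queries made by a deterministic algorithm -/

/-- The points queried by the algorithm on the oracle `f`, in order. -/
def QueryTree.queries {n : ℕ} (f : BoolFun n) : QueryTree n → List (Fin n → Bool)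
  | .leaf _ => []
  | .query x t₀ t₁ => x :: if f x = true then t₁.queries f else t₀.queries f

theorem QueryTree.length_queries_le {n : ℕ} (f : BoolFun n) (t : QueryTree n) :
    (t.queries f).length ≤ t.depth := by
  induction t with
  | leaf b => simp [queries]
  | query x t₀ t₁ h₀ h₁ =>
    simp only [queries, depth, List.length_cons]
    split_ifs <;> omega

/-- The first s answers determine one query more. Thanks to this shift, a resampling that respects
the queries before a jump also keeps the jumping query in place. -/
theorem QueryTree.take_queries_congr {n : ℕ} {f f' : BoolFun n} (t : QueryTree n) (s : ℕ)
    (h : ∀ x ∈ (t.queries f).take s, f' x = f x) :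
    (t.queries f').take (s + 1) = (t.queries f).take (s + 1) := by
  induction t generalizing s with
  | leaf b => simp [queries]
  | query x t₀ t₁ h₀ h₁ =>
    simp only [queries, List.take_succ_cons, List.cons.injEq, true_and]
    cases s with
    | zero => simp
    | succ s =>
      simp only [queries, List.take_succ_cons, List.mem_cons, forall_eq_or_imp] at h
      rw [h.1]
      split_ifs with hx
      · rw [if_pos hx] at h; exact h₁ s h.2
      · rw [if_neg hx] at h; exact h₀ s h.2

theorem QueryTree.queries_congr {n : ℕ} {f f' : BoolFun n} (t : QueryTree n)
    (h : ∀ x ∈ t.queries f, f' x = f x) :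
    t.queries f' = t.queries f ∧ t.run f' = t.run f := by
  induction t with
  | leaf b => simp [queries, run]
  | query x t₀ t₁ h₀ h₁ =>
    simp only [queries, List.mem_cons, forall_eq_or_imp] at h
    simp only [queries, run, h.1]
    split_ifs with hx
    · rw [if_pos hx] at h
      exact ⟨by rw [(h₁ h.2).1], (h₁ h.2).2⟩
    · rw [if_neg hx] at h
      exact ⟨by rw [(h₀ h.2).1], (h₀ h.2).2⟩

/-! ### Active terms and clauses -/

/-- `x` lies in the middle layers. -/
def Mid {n : ℕ} (x : Fin n → Bool) : Prop :=
  ¬ (n : ℝ) / 2 + √(n : ℝ) < (weight x : ℝ) ∧ ¬ (weight x : ℝ) < (n : ℝ) / 2 - √(n : ℝ)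

/-- `i` is one of the first two indices that satisfy `s`. -/
def FirstTwo {N : ℕ} (s : Fin N → Prop) (i : Fin N) : Prop :=
  s i ∧ ∀ a b, a < b → b < i → s a → ¬ s b

/-- Two indices already decide the multiplexer, so later ones need no tracking. This bound lets each
query be charged to two terms or clauses only, however many it satisfies or falsifies. -/
theorem card_firstTwo_le {N : ℕ} (s : Fin N → Prop) :
    (Finset.univ.filter (FirstTwo s)).card ≤ 2 := by
  by_contra h
  push Not at h
  obtain ⟨a, ha, b, hb, c, hc, hab, hac, hbc⟩ := Finset.two_lt_card.1 h
  simp only [Finset.mem_filter, Finset.mem_univ, true_and] at ha hb hc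
  have key : ∀ {a b c}, FirstTwo s a → FirstTwo s b → FirstTwo s c → a < b → b < c → False :=
    fun {_ _ _} ha hb hc h1 h2 => hc.2 _ _ h1 h2 ha.1 hb.1
  rcases lt_or_gt_of_ne hab with h1 | h1 <;> rcases lt_or_gt_of_ne hac with h2 | h2 <;>
    rcases lt_or_gt_of_ne hbc with h3 | h3
  · exact key ha hb hc h1 h3
  · exact key ha hc hb h2 h3
  · exact absurd (h1.trans h3) (not_lt.2 h2.le)
  · exact key hc ha hb h2 h1
  · exact key hb ha hc h1 h2
  · exact absurd (h3.trans h1) (not_lt.2 h2.le)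
  · exact key hb hc ha h3 h2
  · exact key hc hb ha h3 h1

/-- `T_i` is one of the first two terms satisfied by the middle point `x`. -/
def ActiveTerm {n : ℕ} (T : Terms n) (i : Fin (numTerms n)) (x : Fin n → Bool) : Prop :=
  Mid x ∧ FirstTwo (fun i => TermSat (T i) x) i

/-- `T_i` is the only term satisfied by `x`. -/
def SoleTerm {n : ℕ} (T : Terms n) (i : Fin (numTerms n)) (x : Fin n → Bool) : Prop :=
  TermSat (T i) x ∧ ∀ i', TermSat (T i') x → i' = i

/-- `T_i` is the only term satisfied by the middle point `x`, and `C_{i,j}` is one of the first two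
clauses below it falsified by `x`. -/
def ActiveClause {n : ℕ} (T : Terms n) (C : Clauses n) (i j : Fin (numTerms n))
    (x : Fin n → Bool) : Prop :=
  Mid x ∧ SoleTerm T i x ∧ FirstTwo (fun j => ¬ ClauseSat (C i j) x) j

theorem ActiveClause.activeTerm {n : ℕ} {T : Terms n} {C : Clauses n} {i j : Fin (numTerms n)}
    {x : Fin n → Bool} (h : ActiveClause T C i j x) : ActiveTerm T i x :=
  ⟨h.1, h.2.1.1, fun a _ hab hb ha _ => (hab.trans hb).ne (h.2.1.2 a ha)⟩

theorem activeClause_of_mux {n : ℕ} {T : Terms n} {C : Clauses n} {i j : Fin (numTerms n)}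
    {x : Fin n → Bool} (hx : Mid x) (h : mux T C x = .pair i j) : ActiveClause T C i j x := by
  obtain ⟨h1, h2, h3⟩ := mux_eq_pair_iff.1 h
  exact ⟨hx, h1, h2, fun a _ hab hb ha _ => (hab.trans hb).ne (h3 a ha)⟩

theorem card_activeTerm_le {n : ℕ} (T : Terms n) (x : Fin n → Bool) :
    (Finset.univ.filter fun i => ActiveTerm T i x).card ≤ 2 := by
  refine le_trans (Finset.card_le_card fun i => ?_)
    (card_firstTwo_le fun i => TermSat (T i) x)
  simp only [Finset.mem_filter, Finset.mem_univ, true_and]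
  exact fun h => h.2

/-- All active pairs share the sole satisfied term, so the second index determines the pair. -/
theorem card_activeClause_le {n : ℕ} (T : Terms n) (C : Clauses n) (x : Fin n → Bool) :
    (Finset.univ.filter fun g : Fin (numTerms n) × Fin (numTerms n) =>
      ActiveClause T C g.1 g.2 x).card ≤ 2 := by
  by_cases h : ∃ g : Fin (numTerms n) × Fin (numTerms n), ActiveClause T C g.1 g.2 x
  · obtain ⟨g, hg⟩ := h
    refine le_trans (Finset.card_le_card_of_injOn Prod.snd (fun g' hg' => ?_) ?_)
      (card_firstTwo_le fun j => ¬ ClauseSat (C g.1 j) x)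
    · simp only [Finset.coe_filter, Finset.mem_univ, true_and, Set.mem_ofPred_eq] at hg' ⊢
      rw [hg'.2.1.2 _ hg.2.1.1]
      exact hg'.2.2
    · intro a ha b hb hab
      simp only [Finset.coe_filter, Finset.mem_univ, true_and, Set.mem_ofPred_eq] at ha hb
      exact Prod.ext (hb.2.1.2 _ ha.2.1.1) hab
  · push Not at h
    rw [Finset.filter_false_of_mem fun g _ => h g]
    simp

/-! ### Stability of the function under a change of one term or clause -/

/-- The multiplexer in terms of which terms and clauses are satisfied. -/
def muxOf {N : ℕ} (s : Fin N → Prop) (u : Fin N → Fin N → Prop) : MuxVal N :=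
  if ∀ i, ¬ s i then .zeroStar
  else if h : ∃! i, s i then
    if ∀ j, u h.choose j then .oneStar
    else if h' : ∃! j, ¬ u h.choose j then .pair h.choose h'.choose
    else .zeroStar
  else .oneStar

theorem mux_eq_muxOf {n : ℕ} (T : Terms n) (C : Clauses n) (x : Fin n → Bool) :
    mux T C x = muxOf (fun i => TermSat (T i) x) fun i j => ClauseSat (C i j) x := rfl

theorem muxFun_congr {n : ℕ} {T T' : Terms n} {C C' : Clauses n} (H : Bottoms n)
    {x : Fin n → Bool} (h : Mid x → mux T' C' x = mux T C x) :
    muxFun T' C' H x = muxFun T C H x := by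
  rw [muxFun_eq, muxFun_eq]
  split_ifs with h1 h2
  · rfl
  · rfl
  · rw [h ⟨h1, h2⟩]

/-- If `v` and `v'` disagree at `x`, then by `h2` only `v` is satisfied, and by `h1` the term is not
active. At a middle point this means that two earlier terms are satisfied, and the multiplexer is
`1*` whatever stands at `i`. -/
theorem stable_update_term {n : ℕ} (T : Terms n) (C : Clauses n) (H : Bottoms n)
    (i : Fin (numTerms n)) (v v' : Fin (width n) → Fin n) (x : Fin n → Bool)
    (h1 : ActiveTerm (Function.update T i v) i x → TermSat v' x)
    (h2 : ¬ TermSat v x → ¬ TermSat v' x) :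
    muxFun (Function.update T i v') C H x = muxFun (Function.update T i v) C H x ∧
      (ActiveTerm (Function.update T i v') i x ↔ ActiveTerm (Function.update T i v) i x) := by
  by_cases hm : Mid x
  swap
  · exact ⟨muxFun_congr H fun h => absurd h hm, by simp [ActiveTerm, hm]⟩
  by_cases hs : TermSat v x ↔ TermSat v' x
  · have : (fun i' => TermSat (Function.update T i v' i') x) =
        fun i' => TermSat (Function.update T i v i') x := by
      funext i'
      by_cases hi : i' = i
      · subst hi; simpa using hs.symm
      · simp [hi]
    refine ⟨muxFun_congr H fun _ => ?_, ?_⟩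
    · rw [mux_eq_muxOf, mux_eq_muxOf, this]
    · unfold ActiveTerm; rw [this]
  · have hv : TermSat v x := by tauto
    have hv' : ¬ TermSat v' x := by tauto
    have hna : ¬ ActiveTerm (Function.update T i v) i x := fun h => hv' (h1 h)
    have hex : ∃ a b, a < b ∧ b < i ∧ TermSat (T a) x ∧ TermSat (T b) x := by
      by_contra hcon
      push Not at hcon
      refine hna ⟨hm, by simpa using hv, fun a b hab hb ha hb' => ?_⟩
      beta_reduce at ha hb'
      rw [Function.update_of_ne (hab.trans hb).ne] at ha
      rw [Function.update_of_ne hb.ne] at hb'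
      exact hcon a b hab hb ha hb'
    obtain ⟨a, b, hab, hb, ha, hb'⟩ := hex
    have hone : ∀ w, mux (Function.update T i w) C x = .oneStar := fun w =>
      mux_two_terms (i := a) (i' := b) (by rwa [Function.update_of_ne (hab.trans hb).ne])
        (by rwa [Function.update_of_ne hb.ne]) hab.ne
    refine ⟨muxFun_congr H fun _ => by rw [hone, hone], ?_⟩
    refine iff_of_false (fun h => hv' ?_) hna
    simpa using h.2.1

/-- Replace the clause `C_{i,j}` by `c`. -/
def setClause {n : ℕ} (C : Clauses n) (i j : Fin (numTerms n)) (c : Fin (width n) → Fin n) :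
    Clauses n :=
  Function.update C i (Function.update (C i) j c)

theorem setClause_same {n : ℕ} (C : Clauses n) (i j : Fin (numTerms n))
    (c : Fin (width n) → Fin n) : setClause C i j c i j = c := by
  simp [setClause]

theorem setClause_of_ne_right {n : ℕ} (C : Clauses n) (i : Fin (numTerms n))
    {j j' : Fin (numTerms n)} (h : j' ≠ j) (c : Fin (width n) → Fin n) :
    setClause C i j c i j' = C i j' := by
  simp [setClause, h]

theorem setClause_of_ne_left {n : ℕ} (C : Clauses n) {i i' : Fin (numTerms n)}
    (j : Fin (numTerms n)) (h : i' ≠ i) (c : Fin (width n) → Fin n) :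
    setClause C i j c i' = C i' := by
  simp [setClause, h]

theorem mux_congr_of_not_soleTerm {n : ℕ} (T : Terms n) {C C' : Clauses n} {i : Fin (numTerms n)}
    {x : Fin n → Bool} (hC : ∀ i', i' ≠ i → C' i' = C i') (h : ¬ SoleTerm T i x) :
    mux T C' x = mux T C x := by
  by_cases h0 : ∀ i, ¬ TermSat (T i) x
  · rw [mux_none h0, mux_none h0]
  push Not at h0
  obtain ⟨a, ha⟩ := h0
  by_cases h1 : ∀ i', TermSat (T i') x → i' = a
  · have : a ≠ i := by rintro rfl; exact h ⟨ha, h1⟩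
    rw [mux_unique ha h1, mux_unique ha h1, hC a this]
  · push Not at h1
    obtain ⟨a', ha', hne⟩ := h1
    rw [mux_two_terms ha' ha hne, mux_two_terms ha' ha hne]

/-- Dual of `stable_update_term`: clauses below `i` are read only when `T_i` is the sole satisfied
term, and then two earlier falsified clauses force `0*`. -/
theorem stable_setClause {n : ℕ} (T : Terms n) (C : Clauses n) (H : Bottoms n)
    (i j : Fin (numTerms n)) (v v' : Fin (width n) → Fin n) (x : Fin n → Bool)
    (h1 : ActiveClause T (setClause C i j v) i j x → ¬ ClauseSat v' x)
    (h2 : ClauseSat v x → ClauseSat v' x) :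
    muxFun T (setClause C i j v') H x = muxFun T (setClause C i j v) H x ∧
      (ActiveClause T (setClause C i j v') i j x ↔ ActiveClause T (setClause C i j v) i j x) := by
  by_cases hm : Mid x
  swap
  · exact ⟨muxFun_congr H fun h => absurd h hm, by simp [ActiveClause, hm]⟩
  by_cases hsole : SoleTerm T i x
  swap
  · refine ⟨muxFun_congr H fun _ => mux_congr_of_not_soleTerm T (i := i) (fun i' h => ?_) hsole,
      by simp [ActiveClause, hsole]⟩
    rw [setClause_of_ne_left _ _ h, setClause_of_ne_left _ _ h]
  by_cases hs : ClauseSat v x ↔ ClauseSat v' x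
  · have : ∀ i' j', ClauseSat (setClause C i j v' i' j') x =
        ClauseSat (setClause C i j v i' j') x := by
      intro i' j'
      by_cases hi : i' = i
      · subst hi
        by_cases hj : j' = j
        · subst hj; simpa [setClause_same] using hs.symm
        · simp [setClause_of_ne_right _ _ hj]
      · simp [setClause_of_ne_left _ _ hi]
    refine ⟨muxFun_congr H fun _ => ?_, ?_⟩
    · simp only [mux_eq_muxOf, this]
    · simp only [ActiveClause, this]
  · have hv : ¬ ClauseSat v x := by tauto
    have hv' : ClauseSat v' x := by tauto
    have hna : ¬ ActiveClause T (setClause C i j v) i j x := fun h => h1 h hv'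
    have hex : ∃ a b, a < b ∧ b < j ∧ ¬ ClauseSat (C i a) x ∧ ¬ ClauseSat (C i b) x := by
      by_contra hcon
      push Not at hcon
      refine hna ⟨hm, hsole, by simpa [setClause_same] using hv, fun a b hab hb ha hb' => ?_⟩
      beta_reduce at ha hb'
      rw [setClause_of_ne_right _ _ (hab.trans hb).ne] at ha
      rw [setClause_of_ne_right _ _ hb.ne] at hb'
      exact hb' (hcon a b hab hb ha)
    obtain ⟨a, b, hab, hb, ha, hb'⟩ := hex
    have hzero : ∀ w, mux T (setClause C i j w) x = .zeroStar := fun w =>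
      mux_two_clauses (j := a) (j' := b) hsole.1 hsole.2
        (by rwa [setClause_of_ne_right _ _ (hab.trans hb).ne])
        (by rwa [setClause_of_ne_right _ _ hb.ne]) hab.ne
    refine ⟨muxFun_congr H fun _ => by rw [hzero, hzero], ?_⟩
    refine iff_of_false (fun h => h.2.2.1 ?_) hna
    simpa [setClause_same] using hv'

/-! ### Jumps -/

/-- Some point of `l` has property `p`. -/
def Occurs {α : Type} (p : α → Prop) (l : List α) : Prop := ∃ y ∈ l, p y

/-- Coordinates at which all the points of `l` with property `p` have value `b`. -/
def core {n : ℕ} (b : Bool) (p : (Fin n → Bool) → Prop) (l : List (Fin n → Bool)) :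
    Finset (Fin n) :=
  Finset.univ.filter fun k => ∀ y ∈ l, p y → y k = b

/-- The coordinates of the core of the first `s` points that the next point spoils. -/
def lostAt {n : ℕ} (b : Bool) (p : (Fin n → Bool) → Prop) (l : List (Fin n → Bool)) (s : ℕ) :
    Finset (Fin n) :=
  (core b p (l.take s)).filter fun k => ∃ x, l[s]? = some x ∧ x k ≠ b

/-- The point number `s` has property `p`, it is not the first such point, and it spoils more than
`D` coordinates of the core. -/
def Jump {n : ℕ} (D : ℝ) (b : Bool) (p : (Fin n → Bool) → Prop) (l : List (Fin n → Bool))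
    (s : ℕ) : Prop :=
  (∃ x, l[s]? = some x ∧ p x) ∧ (∃ y ∈ l.take s, p y) ∧ D < ((lostAt b p l s).card : ℝ)

/-- Double counting of replacements: if from every `v ∈ F` one may freely move the coordinates of
`v` outside a set of size at most `q` into a set `Δ v` of size at least `D`, staying in `G` and not
changing `Δ`, then `F` is much smaller than `G`. -/
theorem card_mul_le_of_resample {m n q : ℕ} {D : ℝ} (hD : 0 ≤ D)
    (F G : Finset (Fin m → Fin n)) (Δ : (Fin m → Fin n) → Finset (Fin n))
    (hΔ : ∀ v ∈ F, D ≤ (Δ v).card) (hv : ∀ v ∈ F, ∀ k, v k ∉ Δ v)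
    (hW : ∀ v ∈ F, ∃ W : Finset (Fin m), W.card ≤ q ∧
      ∀ v', (∀ k, v' k = v k ∨ (k ∉ W ∧ v' k ∈ Δ v)) → v' ∈ G ∧ Δ v' = Δ v) :
    (F.card : ℝ) * (1 + D / n) ^ (m - q) ≤ G.card := by
  have hW' : ∀ v, ∃ W : Finset (Fin m), v ∈ F → W.card ≤ q ∧
      ∀ v', (∀ k, v' k = v k ∨ (k ∉ W ∧ v' k ∈ Δ v)) → v' ∈ G ∧ Δ v' = Δ v := fun v => by
    by_cases h : v ∈ F
    · obtain ⟨W, hW⟩ := hW v h; exact ⟨W, fun _ => hW⟩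
    · exact ⟨∅, fun h' => absurd h' h⟩
  choose W hW using hW'
  let reach : (Fin m → Fin n) → Finset (Fin m → Fin n) := fun v =>
    Fintype.piFinset fun k => if k ∈ W v then {v k} else insert (v k) (Δ v)
  -- A target weighs n to the power minus the number of its coordinates in Δ. From a fixed source
  -- the total weight factors over coordinates, and each of the at least m - q free ones contributes
  -- 1 + |Δ|/n. For a fixed target, Δ is known and every source agrees with it outside Δ, so the
  -- number of sources is at most the inverse of the weight.
  let wt : Finset (Fin n) → (Fin m → Fin n) → ℝ := fun S v' =>
    ∏ k, if v' k ∈ S then (1 / n : ℝ) else 1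
  have hreach : ∀ v ∈ F, ∀ v' ∈ reach v, v' ∈ G ∧ Δ v' = Δ v := fun v hvF v' hv' => by
    refine (hW v hvF).2 v' fun k => ?_
    have := Fintype.mem_piFinset.1 hv' k
    split_ifs at this with hk
    · exact Or.inl (by simpa using this)
    · rcases Finset.mem_insert.1 this with h | h
      · exact Or.inl h
      · exact Or.inr ⟨hk, h⟩
  have lower : ∀ v ∈ F, (1 + D / n) ^ (m - q) ≤ ∑ v' ∈ reach v, wt (Δ v) v' := by
    intro v hvF
    have e1 : ∑ v' ∈ reach v, wt (Δ v) v' =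
        ∏ k, ∑ a ∈ (if k ∈ W v then {v k} else insert (v k) (Δ v)),
          (if a ∈ Δ v then (1 / n : ℝ) else 1) := by
      rw [Finset.prod_univ_sum]
    have e2 : ∀ k, ∑ a ∈ (if k ∈ W v then {v k} else insert (v k) (Δ v)),
        (if a ∈ Δ v then (1 / n : ℝ) else 1) =
          if k ∈ W v then 1 else 1 + ((Δ v).card / n : ℝ) := by
      intro k
      split_ifs with hk
      · simp [hv v hvF k]
      · rw [Finset.sum_insert (hv v hvF k), if_neg (hv v hvF k),
          Finset.sum_congr rfl fun a ha => if_pos ha]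
        simp [div_eq_mul_inv]
    rw [e1, Finset.prod_congr rfl fun k _ => e2 k, Finset.prod_ite, Finset.prod_const_one, one_mul,
      Finset.prod_const]
    have hcard : m - q ≤ (Finset.univ.filter fun k => k ∉ W v).card := by
      have := Finset.card_filter_add_card_filter_not (s := (Finset.univ : Finset (Fin m)))
        (fun k => k ∈ W v)
      have h3 : (Finset.univ.filter fun k => k ∈ W v).card ≤ q := by
        simpa using (hW v hvF).1
      simp only [Finset.card_univ, Fintype.card_fin] at this
      omega
    calc (1 + D / n) ^ (m - q) ≤ (1 + (Δ v).card / n : ℝ) ^ (m - q) := by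
          gcongr
          exact hΔ v hvF
      _ ≤ _ := pow_le_pow_right₀ (le_add_of_nonneg_right (by positivity)) hcard
  have upper : ∀ v' ∈ G, ∑ v ∈ F with v' ∈ reach v, wt (Δ v) v' ≤ 1 := by
    intro v' _
    have hconst : ∀ v ∈ F.filter (fun v => v' ∈ reach v), wt (Δ v) v' = wt (Δ v') v' := by
      intro v h
      obtain ⟨h1, h2⟩ := Finset.mem_filter.1 h
      rw [(hreach v h1 v' h2).2]
    rw [Finset.sum_congr rfl hconst, Finset.sum_const, nsmul_eq_mul]
    have hsub : F.filter (fun v => v' ∈ reach v) ⊆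
        Fintype.piFinset fun k => if v' k ∈ Δ v' then Finset.univ else {v' k} := by
      intro v h
      obtain ⟨h1, h2⟩ := Finset.mem_filter.1 h
      rw [Fintype.mem_piFinset]
      intro k
      split_ifs with hk
      · simp
      · rw [(hreach v h1 v' h2).2] at hk
        have := Fintype.mem_piFinset.1 h2 k
        split_ifs at this with hkW
        · simpa using (Finset.mem_singleton.1 this).symm
        · rcases Finset.mem_insert.1 this with h | h
          · simpa using h.symm
          · exact absurd h hk
    have hc : ((F.filter fun v => v' ∈ reach v).card : ℝ) ≤
        ∏ k, if v' k ∈ Δ v' then (n : ℝ) else 1 := by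
      have := Finset.card_le_card hsub
      rw [Fintype.card_piFinset] at this
      refine (Nat.cast_le.2 this).trans (le_of_eq ?_)
      push_cast
      refine Finset.prod_congr rfl fun k _ => ?_
      split_ifs <;> simp
    have hwt : 0 ≤ wt (Δ v') v' := Finset.prod_nonneg fun k _ => by positivity
    refine (mul_le_mul_of_nonneg_right hc hwt).trans ?_
    rw [← Finset.prod_mul_distrib]
    refine Finset.prod_le_one (fun k _ => by positivity) fun k _ => ?_
    split_ifs
    · rw [mul_one_div]; exact div_self_le_one _
    · simp
  calc (F.card : ℝ) * (1 + D / n) ^ (m - q) = ∑ v ∈ F, (1 + D / n) ^ (m - q) := by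
        rw [Finset.sum_const, nsmul_eq_mul]
    _ ≤ ∑ v ∈ F, ∑ v' ∈ reach v, wt (Δ v) v' := Finset.sum_le_sum lower
    _ = ∑ v' ∈ G, ∑ v ∈ F with v' ∈ reach v, wt (Δ v) v' := by
        refine Finset.sum_comm' fun v v' => ?_
        rw [Finset.mem_filter]
        exact ⟨fun h => ⟨h, (hreach v h.1 v' h.2).1⟩, fun h => h.1⟩
    _ ≤ ∑ v' ∈ G, 1 := Finset.sum_le_sum upper
    _ = G.card := by simp

/-- One variable per failing point certifies the failure. Freezing these variables preserves all
failures. -/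
theorem exists_witnesses {m n : ℕ} (b : Bool) (v : Fin m → Fin n) (l : List (Fin n → Bool)) :
    ∃ W : Finset (Fin m), W.card ≤ l.length ∧
      ∀ y ∈ l, (¬ ∀ k, y (v k) = b) → ∃ k ∈ W, y (v k) ≠ b := by
  induction l with
  | nil => exact ⟨∅, by simp⟩
  | cons y l ih =>
    obtain ⟨W, hW, h⟩ := ih
    by_cases hy : ∀ k, y (v k) = b
    · refine ⟨W, hW.trans (by simp), fun z hz hz' => ?_⟩
      rcases List.mem_cons.1 hz with rfl | hz
      · exact absurd hy hz'
      · exact h z hz hz'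
    · push Not at hy
      obtain ⟨k, hk⟩ := hy
      refine ⟨insert k W, (Finset.card_insert_le _ _).trans (by simpa using hW),
        fun z hz hz' => ?_⟩
      rcases List.mem_cons.1 hz with rfl | hz
      · exact ⟨k, by simp, hk⟩
      · obtain ⟨k', hk', h'⟩ := h z hz hz'
        exact ⟨k', by simp [hk'], h'⟩

/-- Jumps are rare for a query sequence `l v` that does not reveal too much about `v`. -/
theorem card_jump_mul_le {m n q s : ℕ} {D : ℝ} (hD : 0 ≤ D) (hs : s ≤ q) (b : Bool)
    (l : (Fin m → Fin n) → List (Fin n → Bool)) (p : (Fin m → Fin n) → (Fin n → Bool) → Prop)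
    (h1 : ∀ v y, p v y → ∀ k, y (v k) = b)
    (h2 : ∀ v v', (∀ y ∈ (l v).take s, (p v y → ∀ k, y (v' k) = b) ∧
        ((¬ ∀ k, y (v k) = b) → ¬ ∀ k, y (v' k) = b)) →
      (l v').take (s + 1) = (l v).take (s + 1) ∧ ∀ y ∈ (l v).take s, p v' y ↔ p v y) :
    ((Finset.univ.filter fun v => Jump D b (p v) (l v) s).card : ℝ) * (1 + D / n) ^ (m - q) ≤
      (Finset.univ.filter fun v => Occurs (p v) ((l v).take s)).card := by
  refine card_mul_le_of_resample hD _ _ (fun v => lostAt b (p v) (l v) s) ?_ ?_ ?_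
  · intro v hv
    exact (Finset.mem_filter.1 hv).2.2.2.le
  -- The jumping point has value `b` on all variables of `v`, so none of them is a spoiled
  -- coordinate.
  · intro v hv k hk
    obtain ⟨⟨x, hx, hpx⟩, -, -⟩ := (Finset.mem_filter.1 hv).2
    obtain ⟨x', hx', hne⟩ := (Finset.mem_filter.1 hk).2
    rw [hx, Option.some.injEq] at hx'
    subst hx'
    exact hne (h1 v x hpx k)
  · intro v hv
    obtain ⟨-, ⟨y₀, hy₀, hpy₀⟩, -⟩ := (Finset.mem_filter.1 hv).2
    obtain ⟨W, hWc, hW⟩ := exists_witnesses b v ((l v).take s)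
    refine ⟨W, hWc.trans ((List.length_take_le _ _).trans hs), fun v' hv' => ?_⟩
    obtain ⟨e1, e2⟩ := h2 v v' fun y hy => by
      refine ⟨fun hp k => ?_, fun hns hcon => ?_⟩
      · rcases hv' k with h | ⟨-, h⟩
        · rw [h]; exact h1 v y hp k
        -- A moved variable lands in the core, where every earlier active point has value `b`.
        · have := (Finset.mem_filter.1 h).1
          exact (Finset.mem_filter.1 this).2 y hy hp
      · obtain ⟨k, hkW, hk⟩ := hW y hy hns
        rcases hv' k with h | ⟨h, -⟩
        · exact hk (h ▸ hcon k)
        · exact h hkW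
    have e3 : (l v').take s = (l v).take s := by
      have := congrArg (List.take s) e1
      simpa [List.take_take] using this
    -- The jumping query itself is unchanged too; this is why `h2` concludes about s + 1 entries.
    have e4 : (l v')[s]? = (l v)[s]? := by
      have := congrArg (fun l => l[s]?) e1
      simpa [List.getElem?_take] using this
    refine ⟨?_, ?_⟩
    · rw [Finset.mem_filter]
      exact ⟨Finset.mem_univ _, y₀, e3 ▸ hy₀, (e2 y₀ hy₀).2 hpy₀⟩
    · have e5 : core b (p v') ((l v').take s) = core b (p v) ((l v).take s) := by
        unfold core
        rw [e3]
        ext k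
        simp only [Finset.mem_filter, Finset.mem_univ, true_and]
        exact forall₂_congr fun y hy => by rw [e2 y hy]
      simp only [lostAt, e4, e5]

/-! ### Slicing a finite probability space along one variable -/

/-- Resampling one variable preserves the uniform law: exchanging the stored value with a fresh one
is an involution of Ω × V. -/
theorem sum_slice {Ω V : Type} [Fintype Ω] [Fintype V] (get : Ω → V) (set : Ω → V → Ω)
    (h1 : ∀ ω, set ω (get ω) = ω) (h2 : ∀ ω v, get (set ω v) = v)
    (h3 : ∀ ω v w, set (set ω v) w = set ω w) (φ : Ω → ℝ) :
    ∑ ω, ∑ v, φ (set ω v) = Fintype.card V * ∑ ω, φ ω := by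
  have hinv : Function.Involutive fun p : Ω × V => (set p.1 p.2, get p.1) := by
    rintro ⟨ω, v⟩
    simp only [h3, h1, h2]
  have e := Equiv.sum_comp hinv.toPerm fun p : Ω × V => φ p.1
  simp only [Fintype.sum_prod_type, Finset.sum_const, Finset.card_univ, nsmul_eq_mul] at e
  rw [← Finset.mul_sum] at e
  exact e

theorem sum_card_slice {Ω V : Type} [Fintype Ω] [Fintype V] (get : Ω → V) (set : Ω → V → Ω)
    (h1 : ∀ ω, set ω (get ω) = ω) (h2 : ∀ ω v, get (set ω v) = v)
    (h3 : ∀ ω v w, set (set ω v) w = set ω w) (F : Ω → Prop) :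
    ∑ ω, ((Finset.univ.filter fun v => F (set ω v)).card : ℝ) =
      Fintype.card V * (Finset.univ.filter F).card := by
  rw [← Finset.sum_boole, ← sum_slice get set h1 h2 h3]
  simp only [Finset.sum_boole]

theorem freq_mul_le_of_slice {Ω V : Type} [Fintype Ω] [Fintype V] [Nonempty V] (get : Ω → V)
    (set : Ω → V → Ω) (h1 : ∀ ω, set ω (get ω) = ω) (h2 : ∀ ω v, get (set ω v) = v)
    (h3 : ∀ ω v w, set (set ω v) w = set ω w) {F G : Ω → Prop} {B : ℝ}
    (h : ∀ ω, ((Finset.univ.filter fun v => F (set ω v)).card : ℝ) * B ≤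
      (Finset.univ.filter fun v => G (set ω v)).card) : freq F * B ≤ freq G := by
  have hs := Finset.sum_le_sum fun ω (_ : ω ∈ Finset.univ) => h ω
  rw [← Finset.sum_mul, sum_card_slice get set h1 h2 h3, sum_card_slice get set h1 h2 h3,
    mul_assoc] at hs
  have := le_of_mul_le_mul_left hs (by exact_mod_cast Fintype.card_pos)
  unfold freq
  rw [div_mul_eq_mul_div]
  gcongr

theorem sum_freq_le {α ι : Type} [Fintype α] [Fintype ι] (G : ι → α → Prop) {M : ℕ}
    (h : ∀ a, (Finset.univ.filter fun i => G i a).card ≤ M) : ∑ i, freq (G i) ≤ M := by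
  simp only [freq_eq_sum]
  rw [← Finset.sum_div, Finset.sum_comm]
  have : ∑ a, ∑ i, (if G i a then (1 : ℝ) else 0) ≤ ∑ _a : α, (M : ℝ) := by
    refine Finset.sum_le_sum fun a _ => ?_
    rw [Finset.sum_boole]
    exact_mod_cast h a
  rw [Finset.sum_const, Finset.card_univ, nsmul_eq_mul] at this
  refine (div_le_div_of_nonneg_right this (by positivity)).trans ?_
  rw [mul_div_right_comm]
  exact mul_le_of_le_one_left (by positivity) (div_self_le_one _)

/-! ### Counting -/

/-- Number of entries of `l` with property `p`. -/
def cnt {α : Type} (p : α → Prop) (l : List α) : ℕ := l.countP fun y => decide (p y)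

theorem cnt_pos {α : Type} {p : α → Prop} {l : List α} : 0 < cnt p l ↔ ∃ y ∈ l, p y := by
  simp [cnt, List.countP_pos_iff]

theorem sum_cnt_le {α ι : Type} [Fintype ι] (p : ι → α → Prop) (l : List α) {M : ℕ}
    (h : ∀ a, (Finset.univ.filter fun i => p i a).card ≤ M) :
    ∑ i, cnt (p i) l ≤ M * l.length := by
  induction l with
  | nil => simp [cnt]
  | cons x l ih =>
    have : ∀ i, cnt (p i) (x :: l) = cnt (p i) l + if p i x then 1 else 0 := fun i => by
      simp [cnt, List.countP_cons]
    simp only [this, Finset.sum_add_distrib, List.length_cons, mul_add, mul_one]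
    refine add_le_add ih ?_
    rw [Finset.sum_boole]
    exact h x

theorem card_exists_le {α ι : Type} [Fintype ι] (p : ι → α → Prop) (l : List α) {M : ℕ}
    (h : ∀ a, (Finset.univ.filter fun i => p i a).card ≤ M) :
    (Finset.univ.filter fun i => Occurs (p i) l).card ≤ M * l.length := by
  refine le_trans ?_ (sum_cnt_le p l h)
  rw [Finset.card_filter]
  refine Finset.sum_le_sum fun i _ => ?_
  split_ifs with hi
  · exact cnt_pos.2 hi
  · exact Nat.zero_le _

/-! ### Jumps are unlikely when the bottoms are random constants -/

/-- Choices of one bit for each bottom function. -/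
abbrev Bits (n : ℕ) := Fin (numTerms n) → Fin (numTerms n) → Bool

/-- The function built from constant bottoms. -/
def coinFun {n : ℕ} (ω : (Terms n × Clauses n) × Bits n) : BoolFun n :=
  muxFun ω.1.1 ω.1.2 fun i j _ => ω.2 i j

/-- Only `T_i` is resampled. By `stable_update_term` the answers before step `s` do not notice the
replacements allowed in `card_jump_mul_le`. -/
theorem freq_termJump_mul_le {n q s : ℕ} [NeZero n] {D : ℝ} (hD : 0 ≤ D) (hs : s ≤ q)
    (t : QueryTree n) (i : Fin (numTerms n)) :
    freq (fun ω : (Terms n × Clauses n) × Bits n =>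
        Jump D true (ActiveTerm ω.1.1 i) (t.queries (coinFun ω)) s) *
        (1 + D / n) ^ (width n - q) ≤
      freq fun ω : (Terms n × Clauses n) × Bits n =>
        Occurs (ActiveTerm ω.1.1 i) ((t.queries (coinFun ω)).take s) := by
  refine freq_mul_le_of_slice (fun ω => ω.1.1 i)
    (fun ω v => ((Function.update ω.1.1 i v, ω.1.2), ω.2)) (by simp) (by simp) (by simp)
    fun ω => ?_
  refine card_jump_mul_le hD hs true
    (fun v => t.queries (coinFun ((Function.update ω.1.1 i v, ω.1.2), ω.2)))
    (fun v => ActiveTerm (Function.update ω.1.1 i v) i) ?_ ?_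
  · intro v y hy k
    have := hy.2.1 k
    simpa using this
  · intro v v' h
    have key := fun y hy => stable_update_term ω.1.1 ω.1.2 (fun i j _ => ω.2 i j) i v v' y
      (h y hy).1 (h y hy).2
    exact ⟨t.take_queries_congr s fun x hx => (key x hx).1, fun y hy => (key y hy).2⟩

theorem freq_clauseJump_mul_le {n q s : ℕ} [NeZero n] {D : ℝ} (hD : 0 ≤ D) (hs : s ≤ q)
    (t : QueryTree n) (i j : Fin (numTerms n)) :
    freq (fun ω : (Terms n × Clauses n) × Bits n =>
        Jump D false (ActiveClause ω.1.1 ω.1.2 i j) (t.queries (coinFun ω)) s) *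
        (1 + D / n) ^ (width n - q) ≤
      freq fun ω : (Terms n × Clauses n) × Bits n =>
        Occurs (ActiveClause ω.1.1 ω.1.2 i j) ((t.queries (coinFun ω)).take s) := by
  have hsat : ∀ (c : Fin (width n) → Fin n) (y : Fin n → Bool),
      (∀ k, y (c k) = false) ↔ ¬ ClauseSat c y := fun c y => by simp [ClauseSat]
  refine freq_mul_le_of_slice (fun ω => ω.1.2 i j)
    (fun ω v => ((ω.1.1, setClause ω.1.2 i j v), ω.2)) (by simp [setClause])
    (by simp [setClause]) (by simp [setClause]) fun ω => ?_
  refine card_jump_mul_le hD hs false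
    (fun v => t.queries (coinFun ((ω.1.1, setClause ω.1.2 i j v), ω.2)))
    (fun v => ActiveClause ω.1.1 (setClause ω.1.2 i j v) i j) ?_ ?_
  · intro v y hy
    have := hy.2.2.1
    beta_reduce at this
    rw [setClause_same] at this
    exact (hsat v y).2 this
  · intro v v' h
    simp only [hsat, not_not] at h
    have key := fun y hy => stable_setClause ω.1.1 ω.1.2 (fun i j _ => ω.2 i j) i j v v' y
      (h y hy).1 (h y hy).2
    exact ⟨t.take_queries_congr s fun x hx => (key x hx).1, fun y hy => (key y hy).2⟩

/-- Some query makes a large step away from an active term or clause. -/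
def HasJump {n : ℕ} (D : ℝ) (q : ℕ) (T : Terms n) (C : Clauses n)
    (l : List (Fin n → Bool)) : Prop :=
  ∃ s ∈ Finset.range q, (∃ i ∈ Finset.univ, Jump D true (ActiveTerm T i) l s) ∨
    ∃ g ∈ (Finset.univ : Finset (Fin (numTerms n) × Fin (numTerms n))),
      Jump D false (ActiveClause T C g.1 g.2) l s

/-- The union bound runs over exponentially many terms and clauses but costs little: each jump is
bounded by the probability of having been active before, and these sum to an expected number of at
most 2q active terms and 2q active clauses, for each of q steps. -/
theorem freq_hasJump_mul_le {n q : ℕ} [NeZero n] {D : ℝ} (hD : 0 ≤ D) (t : QueryTree n) :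
    freq (fun ω : (Terms n × Clauses n) × Bits n =>
        HasJump D q ω.1.1 ω.1.2 (t.queries (coinFun ω))) * (1 + D / n) ^ (width n - q) ≤
      4 * q ^ 2 := by
  have hB : (0 : ℝ) ≤ (1 + D / n) ^ (width n - q) := by positivity
  have hlen : ∀ s ∈ Finset.range q, ∀ ω : (Terms n × Clauses n) × Bits n,
      2 * ((t.queries (coinFun ω)).take s).length ≤ 2 * q := fun s hs ω => by
    have := List.length_take_le s (t.queries (coinFun ω))
    have := Finset.mem_range.1 hs
    omega
  have main : ∀ s ∈ Finset.range q, freq (fun ω : (Terms n × Clauses n) × Bits n =>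
      (∃ i ∈ Finset.univ, Jump D true (ActiveTerm ω.1.1 i) (t.queries (coinFun ω)) s) ∨
      ∃ g ∈ (Finset.univ : Finset (Fin (numTerms n) × Fin (numTerms n))),
        Jump D false (ActiveClause ω.1.1 ω.1.2 g.1 g.2) (t.queries (coinFun ω)) s) *
        (1 + D / n) ^ (width n - q) ≤ 4 * q := by
    intro s hs
    have hsq : s ≤ q := (Finset.mem_range.1 hs).le
    refine (mul_le_mul_of_nonneg_right ((freq_or_le _ _).trans
      (add_le_add (freq_exists_le _ _) (freq_exists_le _ _))) hB).trans ?_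
    rw [add_mul, Finset.sum_mul, Finset.sum_mul]
    have a1 := Finset.sum_le_sum fun i (_ : i ∈ Finset.univ) =>
      freq_termJump_mul_le hD hsq t i
    have a2 := Finset.sum_le_sum
      fun (g : Fin (numTerms n) × Fin (numTerms n)) (_ : g ∈ Finset.univ) =>
        freq_clauseJump_mul_le hD hsq t g.1 g.2
    have b1 := sum_freq_le (M := 2 * q) (fun i (ω : (Terms n × Clauses n) × Bits n) =>
      Occurs (ActiveTerm ω.1.1 i) ((t.queries (coinFun ω)).take s)) fun ω =>
        (card_exists_le _ _ fun x => card_activeTerm_le ω.1.1 x).trans (hlen s hs ω)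
    have b2 := sum_freq_le (M := 2 * q)
      (fun (g : Fin (numTerms n) × Fin (numTerms n)) (ω : (Terms n × Clauses n) × Bits n) =>
      Occurs (ActiveClause ω.1.1 ω.1.2 g.1 g.2) ((t.queries (coinFun ω)).take s)) fun ω =>
        (card_exists_le _ _ fun x => card_activeClause_le ω.1.1 ω.1.2 x).trans (hlen s hs ω)
    push_cast at b1 b2
    linarith
  have := Finset.sum_le_sum main
  rw [Finset.sum_const, Finset.card_range, nsmul_eq_mul, ← Finset.sum_mul] at this
  refine (mul_le_mul_of_nonneg_right (freq_exists_le _ _) hB).trans (this.trans (le_of_eq ?_))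
  ring

/-! ### The cores are large when there are no jumps -/

/-- The first point with property `p` starts the core with at least `w` coordinates, each later one
removes at most `D`, and other points change nothing. -/
theorem card_core_ge {n : ℕ} {D w : ℝ} (hD : 0 ≤ D) (b : Bool) (p : (Fin n → Bool) → Prop)
    (hw : ∀ y, p y → w ≤ (Finset.univ.filter fun k => y k = b).card)
    (l : List (Fin n → Bool)) (hl : ∀ s < l.length, ¬ Jump D b p l s) (hex : ∃ y ∈ l, p y) :
    w - D * cnt p l ≤ (core b p l).card := by
  induction l using List.reverseRecOn with
  | nil => simp at hex
  | append_singleton l x ih =>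
    have hl' : ∀ s < l.length, ¬ Jump D b p l s := by
      intro s hs hj
      refine hl s (by simp; omega) ?_
      have e1 : (l ++ [x]).take s = l.take s := List.take_append_of_le_length hs.le
      have e2 : (l ++ [x])[s]? = l[s]? := List.getElem?_append_left hs
      simpa only [Jump, lostAt, e1, e2] using hj
    have hcnt : cnt p (l ++ [x]) = cnt p l + if p x then 1 else 0 := by
      simp [cnt, List.countP_append]
    by_cases hx : p x
    · by_cases hl0 : ∃ y ∈ l, p y
      · have e1 : (l ++ [x]).take l.length = l := by simp
        have e2 : (l ++ [x])[l.length]? = some x := by simp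
        have hnj := hl l.length (by simp)
        have hlost : ((lostAt b p (l ++ [x]) l.length).card : ℝ) ≤ D := by
          by_contra hlt
          exact hnj ⟨⟨x, e2, hx⟩, by rwa [e1], not_le.1 hlt⟩
        have hsub : core b p l \ lostAt b p (l ++ [x]) l.length ⊆ core b p (l ++ [x]) := by
          intro k hk
          simp only [lostAt, e1, e2, Finset.mem_sdiff, Finset.mem_filter, core, Finset.mem_univ,
            true_and, Option.some.injEq, exists_eq_left', not_and, not_not] at hk ⊢
          intro y hy hpy
          rcases List.mem_append.1 hy with hy | hy
          · exact hk.1 y hy hpy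
          · rw [List.mem_singleton.1 hy]
            exact hk.2 hk.1
        have h1 := Finset.card_le_card hsub
        have h2 := Finset.le_card_sdiff (lostAt b p (l ++ [x]) l.length) (core b p l)
        have h3 : ((core b p l).card : ℝ) ≤ (core b p (l ++ [x])).card +
            (lostAt b p (l ++ [x]) l.length).card := by
          exact_mod_cast (by omega : (core b p l).card ≤ (core b p (l ++ [x])).card +
            (lostAt b p (l ++ [x]) l.length).card)
        have := ih hl' hl0
        rw [hcnt, if_pos hx]
        push_cast
        linarith
      · have hsub : (Finset.univ.filter fun k => x k = b) ⊆ core b p (l ++ [x]) := by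
          intro k hk
          simp only [Finset.mem_filter, core, Finset.mem_univ, true_and] at hk ⊢
          intro y hy hpy
          rcases List.mem_append.1 hy with hy | hy
          · exact absurd ⟨y, hy, hpy⟩ hl0
          · rw [List.mem_singleton.1 hy]; exact hk
        have h1 : ((Finset.univ.filter fun k => x k = b).card : ℝ) ≤ (core b p (l ++ [x])).card :=
          by exact_mod_cast Finset.card_le_card hsub
        have := hw x hx
        have : 0 ≤ D * (cnt p (l ++ [x]) : ℝ) := by positivity
        linarith
    · have hcore : core b p (l ++ [x]) = core b p l := by
        ext k
        simp [core, or_imp, forall_and, hx]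
      rw [hcnt, if_neg hx, hcore, add_zero]
      refine ih hl' ?_
      obtain ⟨y, hy, hpy⟩ := hex
      rcases List.mem_append.1 hy with hy | hy
      · exact ⟨y, hy, hpy⟩
      · rw [List.mem_singleton.1 hy] at hpy; exact absurd hpy hx

theorem core_anti {n : ℕ} {b : Bool} {p p' : (Fin n → Bool) → Prop} (h : ∀ y, p y → p' y)
    (l : List (Fin n → Bool)) : core b p' l ⊆ core b p l := by
  intro k hk
  simp only [core, Finset.mem_filter, Finset.mem_univ, true_and] at hk ⊢
  exact fun y hy hpy => hk y hy (h y hpy)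

theorem card_false_eq {n : ℕ} (x : Fin n → Bool) :
    ((Finset.univ.filter fun k => x k = false).card : ℝ) = n - weight x := by
  have := Finset.card_filter_add_card_filter_not (s := (Finset.univ : Finset (Fin n)))
    (fun k => x k = true)
  simp only [Bool.not_eq_true, Finset.card_univ, Fintype.card_fin] at this
  rw [eq_sub_iff_add_eq, add_comm]
  exact_mod_cast this

theorem Mid.le_card {n : ℕ} {x : Fin n → Bool} (h : Mid x) (b : Bool) :
    (n : ℝ) / 2 - √n ≤ (Finset.univ.filter fun k => x k = b).card := by
  obtain ⟨h1, h2⟩ := h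
  push Not at h1 h2
  cases b
  · rw [card_false_eq]; linarith
  · exact h2

/-- A large common zero set of nearly balanced points forces a large common one set. -/
theorem card_core_true_ge {n : ℕ} {B : ℝ} (p : (Fin n → Bool) → Prop) (hp : ∀ y, p y → Mid y)
    (l : List (Fin n → Bool)) (hex : ∃ y ∈ l, p y)
    (hB : (n : ℝ) / 2 - √n - B ≤ (core false p l).card) :
    (n : ℝ) / 2 - √n - cnt p l * (2 * √n + B) ≤ (core true p l).card := by
  -- All ones of all points with property `p` lie in `U`, which has at most n/2 + √n + B elements.
  -- Each such point has at least n/2 - √n ones, so it misses at most 2√n + B elements of `U`.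
  set U : Finset (Fin n) := (core false p l)ᶜ with hU
  have hUc : (U.card : ℝ) = n - (core false p l).card := by
    have := Finset.card_add_card_compl (core false p l)
    rw [Fintype.card_fin] at this
    rw [eq_sub_iff_add_eq, add_comm]
    exact_mod_cast this
  have hsubU : ∀ y ∈ l, p y → (Finset.univ.filter fun k => y k = true) ⊆ U := by
    intro y hy hpy k hk
    simp only [hU, core, Finset.mem_filter, Finset.mem_univ, true_and, Finset.mem_compl] at hk ⊢
    intro h
    have := h y hy hpy
    rw [hk] at this
    cases this
  have hcov : U ⊆ core true p l ∪ (l.filter fun y => decide (p y)).toFinset.biUnion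
      (fun y => U \ Finset.univ.filter fun k => y k = true) := by
    intro k hk
    by_cases hc : k ∈ core true p l
    · exact Finset.mem_union_left _ hc
    · refine Finset.mem_union_right _ ?_
      simp only [core, Finset.mem_filter, Finset.mem_univ, true_and] at hc
      push Not at hc
      obtain ⟨y, hy, hpy, hyk⟩ := hc
      rw [Finset.mem_biUnion]
      exact ⟨y, by simp [hy, hpy], by simp [hk, hyk]⟩
  have hterm : ∀ y ∈ (l.filter fun y => decide (p y)).toFinset,
      ((U \ Finset.univ.filter fun k => y k = true).card : ℝ) ≤ 2 * √n + B := by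
    intro y hy
    have hy' : y ∈ l ∧ p y := by simpa using hy
    rw [Finset.card_sdiff_of_subset (hsubU y hy'.1 hy'.2),
      Nat.cast_sub (Finset.card_le_card (hsubU y hy'.1 hy'.2)), hUc]
    have := (hp y hy'.2).le_card true
    linarith
  obtain ⟨y₀, hy₀, hpy₀⟩ := hex
  have h0 : (0 : ℝ) ≤ 2 * √n + B :=
    le_trans (Nat.cast_nonneg _) (hterm y₀ (by simp [hy₀, hpy₀]))
  have hcard : ((l.filter fun y => decide (p y)).toFinset.card : ℝ) ≤ cnt p l := by
    have := List.toFinset_card_le (l.filter fun y => decide (p y))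
    rw [cnt, List.countP_eq_length_filter]
    exact_mod_cast this
  have hsum : (((l.filter fun y => decide (p y)).toFinset.biUnion
      (fun y => U \ Finset.univ.filter fun k => y k = true)).card : ℝ) ≤
        cnt p l * (2 * √n + B) := by
    have h1 : (((l.filter fun y => decide (p y)).toFinset.biUnion
      (fun y => U \ Finset.univ.filter fun k => y k = true)).card : ℝ) ≤
        ∑ y ∈ (l.filter fun y => decide (p y)).toFinset,
          ((U \ Finset.univ.filter fun k => y k = true).card : ℝ) := by
      exact_mod_cast Finset.card_biUnion_le
    refine h1.trans ((Finset.sum_le_sum hterm).trans ?_)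
    rw [Finset.sum_const, nsmul_eq_mul]
    exact mul_le_mul_of_nonneg_right hcard h0
  have hfin : (U.card : ℝ) ≤ (core true p l).card +
      ((l.filter fun y => decide (p y)).toFinset.biUnion
      (fun y => U \ Finset.univ.filter fun k => y k = true)).card := by
    exact_mod_cast (Finset.card_le_card hcov).trans (Finset.card_union_le _ _)
  have hU0 : ((Finset.univ.filter fun k => y₀ k = true).card : ℝ) ≤ U.card := by
    exact_mod_cast Finset.card_le_card (hsubU y₀ hy₀ hpy₀)
  have := (hp y₀ hpy₀).le_card true
  linarith

/-- Common zeros lose at most `D` per query active at the clause. Common ones are controlled in two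
ways: through the term, which may be active at all `q` queries, with loss of order Dq, and through
the common zeros by `card_core_true_ge`, with loss of order DP². As min(P², q) ≤ √q·P, the loss is
linear in `P`, so it can be summed over all clauses. -/
theorem card_core_activeClause_ge {n q : ℕ} {D : ℝ} (hD : √n ≤ D) {T : Terms n} {C : Clauses n}
    {l : List (Fin n → Bool)} (hlen : l.length ≤ q) (hj : ¬ HasJump D q T C l)
    (i j : Fin (numTerms n)) (hex : ∃ y ∈ l, ActiveClause T C i j y) (b : Bool) :
    (n : ℝ) / 2 - 4 * D * √q * cnt (ActiveClause T C i j) l ≤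
      (core b (ActiveClause T C i j) l).card := by
  have hn : (0 : ℝ) ≤ √n := Real.sqrt_nonneg _
  have hD0 : 0 ≤ D := hn.trans hD
  set P := cnt (ActiveClause T C i j) l with hP
  have hP1 : 1 ≤ P := cnt_pos.2 hex
  have hPq : P ≤ q := (List.countP_le_length).trans hlen
  have hP1' : (1 : ℝ) ≤ P := by exact_mod_cast hP1
  have hq1 : (1 : ℝ) ≤ √q := by
    rw [Real.one_le_sqrt]; exact_mod_cast hP1.trans hPq
  have hfalse : (n : ℝ) / 2 - √n - D * P ≤ (core false (ActiveClause T C i j) l).card := by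
    refine card_core_ge hD0 false _ (fun y hy => hy.1.le_card false) l (fun s hs hjump => hj ?_) hex
    exact ⟨s, Finset.mem_range.2 (by omega), Or.inr ⟨(i, j), Finset.mem_univ _, hjump⟩⟩
  have hDP : D ≤ D * P := le_mul_of_one_le_right hD0 hP1'
  have hDPq : D * P ≤ D * √q * P := by
    have := mul_le_mul_of_nonneg_left hq1 (mul_nonneg hD0 (zero_le_one.trans hP1'))
    linarith
  cases b
  · linarith
  · have htrue := card_core_true_ge (ActiveClause T C i j) (fun y hy => hy.1) l hex hfalse
    rw [← hP] at htrue
    have hterm : (n : ℝ) / 2 - √n - D * q ≤ (core true (ActiveClause T C i j) l).card := by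
      have h1 : (n : ℝ) / 2 - √n - D * cnt (ActiveTerm T i) l ≤
          (core true (ActiveTerm T i) l).card := by
        obtain ⟨y, hy, hpy⟩ := hex
        refine card_core_ge hD0 true _ (fun y hy => hy.1.le_card true) l (fun s hs hjump => hj ?_)
          ⟨y, hy, hpy.activeTerm⟩
        exact ⟨s, Finset.mem_range.2 (by omega), Or.inl ⟨i, Finset.mem_univ _, hjump⟩⟩
      have h2 : ((core true (ActiveTerm T i) l).card : ℝ) ≤
          (core true (ActiveClause T C i j) l).card := by
        exact_mod_cast Finset.card_le_card
          (core_anti (fun y (hy : ActiveClause T C i j y) => hy.activeTerm) l)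
      have h3 : (cnt (ActiveTerm T i) l : ℝ) ≤ q := by
        exact_mod_cast (List.countP_le_length).trans hlen
      have := mul_le_mul_of_nonneg_left h3 hD0
      linarith
    have hqq : √(q : ℝ) * √q = q := Real.mul_self_sqrt (Nat.cast_nonneg _)
    -- For P ≤ √q the bound through the zeros is used: √n + 2√n·P + DP² ≤ 4D√q·P. For P ≥ √q the
    -- bound through the term is used: √n + Dq ≤ 2D√q·P.
    rcases le_total (P : ℝ) (√q) with h | h
    · have h1 : D * (P * P) ≤ D * (√q * P) := by gcongr
      have h2 : √n * P ≤ D * P := by gcongr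
      nlinarith
    · have h1 : D * (√q * √q) ≤ D * (√q * P) := by gcongr
      rw [hqq] at h1
      nlinarith

/-! ### Comparison of random bottoms with random constants -/

theorem one_sub_sum_le_prod {ι : Type} (s : Finset ι) (r : ι → ℝ) (h0 : ∀ i ∈ s, 0 ≤ r i)
    (h1 : ∀ i ∈ s, r i ≤ 1) : 1 - ∑ i ∈ s, r i ≤ ∏ i ∈ s, (1 - r i) := by
  induction s using Finset.induction_on with
  | empty => simp
  | insert i s hi ih =>
    rw [Finset.sum_insert hi, Finset.prod_insert hi]
    have h := ih (fun j hj => h0 j (Finset.mem_insert_of_mem hj))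
      fun j hj => h1 j (Finset.mem_insert_of_mem hj)
    have hi0 := h0 i (Finset.mem_insert_self _ _)
    have hi1 := h1 i (Finset.mem_insert_self _ _)
    have hs : 0 ≤ ∑ j ∈ s, r j :=
      Finset.sum_nonneg fun j hj => h0 j (Finset.mem_insert_of_mem hj)
    have := mul_le_mul_of_nonneg_left h (sub_nonneg.2 hi1)
    nlinarith [mul_nonneg hi0 hs]

/-- A likelihood-ratio bound, summed over the values attained at good points. One good point per
value suffices, because the hypothesis speaks of its whole fiber. -/
theorem freq_fiber_le {α β L : Type} [Fintype α] [Fintype β] (p : α → L) (p' : β → L)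
    (Good : α → Prop) (S : L → Prop) {c : ℝ} (hc : 0 ≤ c)
    (h : ∀ a, Good a → c * freq (fun a' => p a' = p a) ≤ freq fun b => p' b = p a) :
    c * freq (fun a => S (p a) ∧ Good a) ≤ freq fun b => S (p' b) := by
  set I : Finset L := (Finset.univ.filter fun a => S (p a) ∧ Good a).image p with hI
  have h1 : freq (fun a => S (p a) ∧ Good a) ≤ ∑ ℓ ∈ I, freq fun a => p a = ℓ := by
    refine (freq_mono fun a ha => ?_).trans (freq_exists_le I fun ℓ a => p a = ℓ)
    exact ⟨p a, Finset.mem_image_of_mem p (by simpa using ha), rfl⟩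
  have h2 : ∀ ℓ ∈ I, c * freq (fun a => p a = ℓ) ≤ freq fun b => p' b = ℓ := by
    intro ℓ hℓ
    obtain ⟨a, ha, rfl⟩ := Finset.mem_image.1 hℓ
    exact h a (Finset.mem_filter.1 ha).2.2
  have h3 : ∑ ℓ ∈ I, freq (fun b => p' b = ℓ) ≤ freq fun b => S (p' b) := by
    simp only [freq_eq_sum]
    rw [← Finset.sum_div, Finset.sum_comm]
    gcongr with b
    rw [Finset.sum_ite_eq]
    split_ifs with hm hS hS
    · exact le_rfl
    · obtain ⟨a, ha, hab⟩ := Finset.mem_image.1 hm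
      exact absurd (hab ▸ (Finset.mem_filter.1 ha).2.1) hS
    · exact zero_le_one
    · exact le_rfl
  calc c * freq (fun a => S (p a) ∧ Good a) ≤ c * ∑ ℓ ∈ I, freq fun a => p a = ℓ := by gcongr
    _ = ∑ ℓ ∈ I, c * freq fun a => p a = ℓ := Finset.mul_sum _ _ _
    _ ≤ ∑ ℓ ∈ I, freq fun b => p' b = ℓ := Finset.sum_le_sum h2
    _ ≤ _ := h3

theorem freq_eq_card_div {α : Type} [Fintype α] {P : α → Prop} {s : Finset α}
    (h : ∀ a, a ∈ s ↔ P a) : freq P = (s.card : ℝ) / Fintype.card α := by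
  have : Finset.univ.filter P = s := by ext a; simp [h]
  rw [freq, this]

theorem freq_forall₂_mem {ι ι' α : Type} [Fintype ι] [Fintype ι'] [DecidableEq ι]
    [DecidableEq ι'] [Fintype α] (S : ι → ι' → Finset α) :
    freq (fun c : ι → ι' → α => ∀ i j, c i j ∈ S i j) =
      ∏ g : ι × ι', ((S g.1 g.2).card : ℝ) / Fintype.card α := by
  rw [freq_eq_card_div (s := Fintype.piFinset fun i => Fintype.piFinset fun j => S i j)
    (by simp [Fintype.mem_piFinset]), Finset.prod_div_distrib, Fintype.card_piFinset]
  simp only [Fintype.card_piFinset, Fintype.card_pi, Fintype.prod_prod_type, Nat.cast_prod]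

/-- The pair `(i, j)` is selected by some middle point of `l`. -/
def Touched {n : ℕ} (T : Terms n) (C : Clauses n) (l : List (Fin n → Bool))
    (i j : Fin (numTerms n)) : Prop :=
  Occurs (fun x => Mid x ∧ mux T C x = .pair i j) l

theorem muxFun_of_mid {n : ℕ} {T : Terms n} {C : Clauses n} (H : Bottoms n) {x : Fin n → Bool}
    (hx : Mid x) : muxFun T C H x = muxVal H x (mux T C x) := by
  rw [muxFun_eq, if_neg hx.1, if_neg hx.2]

theorem muxFun_congr_bottoms {n : ℕ} {T : Terms n} {C : Clauses n} {H H' : Bottoms n}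
    {x : Fin n → Bool} (h : ∀ i j, Mid x → mux T C x = .pair i j → H' i j x = H i j x) :
    muxFun T C H' x = muxFun T C H x := by
  by_cases hx : Mid x
  · rw [muxFun_of_mid _ hx, muxFun_of_mid _ hx]
    cases hm : mux T C x with
    | zeroStar => rfl
    | oneStar => rfl
    | pair i j => exact h i j hx hm
  · rw [muxFun_eq, muxFun_eq]
    split_ifs with h1 h2
    · rfl
    · rfl
    · exact absurd ⟨h1, h2⟩ hx

/-- The function built from dictators (`a = false`) or anti-dictators (`a = true`). -/
def dictFun {n : ℕ} (a : Bool) (ω : (Terms n × Clauses n) × Dicts n) : BoolFun n :=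
  muxFun ω.1.1 ω.1.2 fun i j x => xor (x (ω.2 i j)) a

/-- The points queried on the oracle `f` with the answers, and the verdict. -/
def transcript {n : ℕ} (t : QueryTree n) (f : BoolFun n) : List ((Fin n → Bool) × Bool) × Bool :=
  ((t.queries f).map fun x => (x, f x), t.run f)

theorem transcript_congr {n : ℕ} {t : QueryTree n} {f f' : BoolFun n}
    (h : ∀ x ∈ t.queries f, f' x = f x) : transcript t f' = transcript t f := by
  obtain ⟨h1, h2⟩ := t.queries_congr h
  unfold transcript
  rw [h1, h2]
  refine Prod.ext (List.map_congr_left fun x hx => ?_) rfl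
  rw [h x hx]

theorem eq_of_transcript_eq {n : ℕ} {t : QueryTree n} {f f' : BoolFun n}
    (h : transcript t f' = transcript t f) {x : Fin n → Bool} (hx : x ∈ t.queries f) :
    f' x = f x := by
  have h1 : (x, f x) ∈ (transcript t f').1 := by
    rw [h]; exact List.mem_map.2 ⟨x, hx, rfl⟩
  obtain ⟨y, -, hy⟩ := List.mem_map.1 h1
  injection hy with e1 e2
  rw [← e1, e1] at e2
  exact e2

theorem sum_cnt_activeClause_le {n q : ℕ} (T : Terms n) (C : Clauses n)
    {l : List (Fin n → Bool)} (hl : l.length ≤ q) :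
    (∑ g : Fin (numTerms n) × Fin (numTerms n), (cnt (ActiveClause T C g.1 g.2) l : ℝ)) ≤ 2 * q := by
  have := sum_cnt_le (fun (g : Fin (numTerms n) × Fin (numTerms n)) => ActiveClause T C g.1 g.2) l
    fun x => card_activeClause_le T C x
  exact_mod_cast this.trans (by omega)

/-- Both sides become products over pairs. Equality of transcripts forces the bit at each touched
pair, while choosing each touched variable in its core suffices for equality on the other side.
Factor by factor the ratio is at least 1 - r, and the product of these is at least 1 - ∑ r. -/
theorem freq_transcript_ge {n q : ℕ} [NeZero n] {D : ℝ} (hD : √n ≤ D)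
    (hη : 16 * D * √q * q / n ≤ 1) (T : Terms n) (C : Clauses n) (t : QueryTree n)
    (ht : t.depth ≤ q) (a : Bool) (c : Bits n)
    (hj : ¬ HasJump D q T C (t.queries (coinFun ((T, C), c)))) :
    (1 - 16 * D * √q * q / n) *
        freq (fun c' : Bits n => transcript t (coinFun ((T, C), c')) =
          transcript t (coinFun ((T, C), c))) ≤
      freq fun κ : Dicts n => transcript t (dictFun a ((T, C), κ)) =
          transcript t (coinFun ((T, C), c)) := by
  set l := t.queries (coinFun ((T, C), c)) with hl
  have hlen : l.length ≤ q := (t.length_queries_le _).trans ht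
  have hn : (0 : ℝ) < n := by exact_mod_cast Nat.pos_of_ne_zero (NeZero.ne n)
  have hD0 : 0 ≤ D := (Real.sqrt_nonneg _).trans hD
  let R : Fin (numTerms n) → Fin (numTerms n) → Finset Bool := fun i j =>
    if Touched T C l i j then {c i j} else Finset.univ
  let S : Fin (numTerms n) → Fin (numTerms n) → Finset (Fin n) := fun i j =>
    -- The bottom returns x_κ xor `a`, so the value required of x_κ is `c i j` xor `a`.
    if Touched T C l i j then core (xor (c i j) a) (ActiveClause T C i j) l else Finset.univ
  let r : Fin (numTerms n) × Fin (numTerms n) → ℝ := fun g =>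
    -- The relative loss of the core with respect to n/2; the counts sum to at most 2q, whence the
    -- 16.
    8 * D * √q * cnt (ActiveClause T C g.1 g.2) l / n
  have hr0 : ∀ g, 0 ≤ r g := fun g => by positivity
  have hrsum : ∑ g, r g ≤ 16 * D * √q * q / n := by
    have := sum_cnt_activeClause_le T C hlen
    have h8 : 0 ≤ 8 * D * √q := by positivity
    rw [← Finset.sum_div, ← Finset.mul_sum]
    refine div_le_div_of_nonneg_right ?_ hn.le
    refine (mul_le_mul_of_nonneg_left this h8).trans (le_of_eq ?_)
    ring
  have hr1 : ∀ g, r g ≤ 1 := fun g =>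
    (Finset.single_le_sum (fun g _ => hr0 g) (Finset.mem_univ g)).trans (hrsum.trans hη)
  have hprod : 1 - 16 * D * √q * q / n ≤ ∏ g, (1 - r g) :=
    le_trans (by linarith) (one_sub_sum_le_prod Finset.univ r (fun g _ => hr0 g) fun g _ => hr1 g)
  have hR : freq (fun c' : Bits n => transcript t (coinFun ((T, C), c')) =
      transcript t (coinFun ((T, C), c))) ≤
      ∏ g : Fin (numTerms n) × Fin (numTerms n), ((R g.1 g.2).card : ℝ) / (2 : ℕ) := by
    have e := freq_forall₂_mem R
    rw [Fintype.card_bool] at e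
    refine le_trans (freq_mono fun c' hc' i j => ?_) e.le
    simp only [R]
    split_ifs with htc
    · obtain ⟨x, hx, hmid, hm⟩ := htc
      have := eq_of_transcript_eq hc' hx
      simp only [coinFun, muxFun_of_mid _ hmid, hm, muxVal] at this
      simpa using this
    · exact Finset.mem_univ _
  have hS : ∏ g : Fin (numTerms n) × Fin (numTerms n), ((S g.1 g.2).card : ℝ) / n ≤
      freq fun κ : Dicts n => transcript t (dictFun a ((T, C), κ)) =
          transcript t (coinFun ((T, C), c)) := by
    have e := freq_forall₂_mem S
    rw [Fintype.card_fin] at e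
    refine e.ge.trans (freq_mono fun κ hκ => transcript_congr fun x hx => ?_)
    refine muxFun_congr_bottoms fun i j hmid hm => ?_
    have htc : Touched T C l i j := ⟨x, hx, hmid, hm⟩
    have hk := hκ i j
    simp only [S, if_pos htc] at hk
    have := (Finset.mem_filter.1 hk).2 x hx (activeClause_of_mux hmid hm)
    simp only [this]
    cases a <;> simp
  refine (mul_le_mul hprod hR (freq_nonneg _) (Finset.prod_nonneg fun g _ =>
    sub_nonneg.2 (hr1 g))).trans (le_trans ?_ hS)
  rw [← Finset.prod_mul_distrib]
  refine Finset.prod_le_prod (fun g _ => mul_nonneg (sub_nonneg.2 (hr1 g)) (by positivity))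
    fun g _ => ?_
  by_cases htc : Touched T C l g.1 g.2
  · simp only [R, S, if_pos htc, Finset.card_singleton, r]
    obtain ⟨x, hx, hmid, hm⟩ := htc
    have := card_core_activeClause_ge hD hlen hj g.1 g.2 ⟨x, hx, activeClause_of_mux hmid hm⟩
      (xor (c g.1 g.2) a)
    rw [le_div_iff₀ hn]
    refine le_trans (le_of_eq ?_) this
    field_simp
    push_cast
    ring
  · simp only [R, S, if_neg htc, Finset.card_univ, Fintype.card_bool, Fintype.card_fin]
    rw [div_self hn.ne']
    have := hr0 g
    push_cast
    linarith

theorem freq_run_dictFun_ge {n q : ℕ} [NeZero n] {D : ℝ} (hD : √n ≤ D)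
    (hη : 16 * D * √q * q / n ≤ 1) (t : QueryTree n) (ht : t.depth ≤ q) (a v : Bool) :
    freq (fun ω : (Terms n × Clauses n) × Bits n => t.run (coinFun ω) = v) -
        16 * D * √q * q / n -
        freq (fun ω : (Terms n × Clauses n) × Bits n =>
          HasJump D q ω.1.1 ω.1.2 (t.queries (coinFun ω))) ≤
      freq fun ω : (Terms n × Clauses n) × Dicts n => t.run (dictFun a ω) = v := by
  have hD0 : 0 ≤ D := (Real.sqrt_nonneg _).trans hD
  set η := 16 * D * √q * q / n
  have hη0 : 0 ≤ η := by positivity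
  have main : (1 - η) * freq (fun ω : (Terms n × Clauses n) × Bits n =>
      t.run (coinFun ω) = v ∧ ¬ HasJump D q ω.1.1 ω.1.2 (t.queries (coinFun ω))) ≤
      freq fun ω : (Terms n × Clauses n) × Dicts n => t.run (dictFun a ω) = v := by
    rw [freq_prod, freq_prod, mul_div_assoc', Finset.mul_sum]
    refine div_le_div_of_nonneg_right (Finset.sum_le_sum fun TC _ => ?_) (Nat.cast_nonneg _)
    exact freq_fiber_le (fun c : Bits n => transcript t (coinFun (TC, c)))
      (fun κ : Dicts n => transcript t (dictFun a (TC, κ)))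
      (fun c => ¬ HasJump D q TC.1 TC.2 (t.queries (coinFun (TC, c)))) (fun ℓ => ℓ.2 = v)
      (by linarith) fun c hc => freq_transcript_ge hD hη TC.1 TC.2 t ht a c hc
  have hsplit : freq (fun ω : (Terms n × Clauses n) × Bits n => t.run (coinFun ω) = v) ≤
      freq (fun ω : (Terms n × Clauses n) × Bits n =>
        t.run (coinFun ω) = v ∧ ¬ HasJump D q ω.1.1 ω.1.2 (t.queries (coinFun ω))) +
      freq (fun ω : (Terms n × Clauses n) × Bits n =>
          HasJump D q ω.1.1 ω.1.2 (t.queries (coinFun ω))) := by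
    refine (freq_mono fun ω hω => ?_).trans (freq_or_le _ _)
    by_cases h : HasJump D q ω.1.1 ω.1.2 (t.queries (coinFun ω))
    · exact Or.inr h
    · exact Or.inl ⟨hω, h⟩
  have hle1 : freq (fun ω : (Terms n × Clauses n) × Bits n =>
        t.run (coinFun ω) = v ∧ ¬ HasJump D q ω.1.1 ω.1.2 (t.queries (coinFun ω))) ≤ 1 := by
    refine div_le_one_of_le₀ ?_ (by positivity)
    exact_mod_cast Finset.card_le_univ _
  nlinarith

/-- The two verdicts are complementary, so lower bounds for both also give upper bounds. -/
theorem abs_freq_run_sub_le {n q : ℕ} [NeZero n] {D : ℝ} (hD : √n ≤ D)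
    (hη : 16 * D * √q * q / n ≤ 1) (t : QueryTree n) (ht : t.depth ≤ q) (a : Bool) :
    |freq (fun ω : (Terms n × Clauses n) × Dicts n => t.run (dictFun a ω) = true) -
        freq (fun ω : (Terms n × Clauses n) × Bits n => t.run (coinFun ω) = true)| ≤
      16 * D * √q * q / n + freq (fun ω : (Terms n × Clauses n) × Bits n =>
          HasJump D q ω.1.1 ω.1.2 (t.queries (coinFun ω))) := by
  have h1 := freq_run_dictFun_ge hD hη t ht a true
  have h2 := freq_run_dictFun_ge hD hη t ht a false
  have e1 := freq_add_not fun ω : (Terms n × Clauses n) × Dicts n => t.run (dictFun a ω) = true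
  have e2 := freq_add_not fun ω : (Terms n × Clauses n) × Bits n => t.run (coinFun ω) = true
  simp only [Bool.not_eq_true] at e1 e2
  rw [abs_le]
  constructor <;> linarith

/-! ### Indistinguishability -/

theorem abs_prob_run_sub_le {n q : ℕ} [NeZero n] {D : ℝ} (hD : √n ≤ D)
    (hη : 16 * D * √q * q / n ≤ 1) (t : QueryTree n) (ht : t.depth ≤ q) :
    |prob (distYes n) {f | t.run f = true} - prob (distNo n) {f | t.run f = true}| ≤
      2 * (16 * D * √q * q / n + 4 * q ^ 2 / (1 + D / n) ^ (width n - q)) := by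
  have hD0 : 0 ≤ D := (Real.sqrt_nonneg _).trans hD
  have hy : prob (distYes n) {f | t.run f = true} =
      freq fun ω : (Terms n × Clauses n) × Dicts n => t.run (dictFun false ω) = true := by
    rw [prob_distYes]
    simp only [dictFun, Bool.xor_false]
    rfl
  have hno : prob (distNo n) {f | t.run f = true} =
      freq fun ω : (Terms n × Clauses n) × Dicts n => t.run (dictFun true ω) = true := by
    rw [prob_distNo]
    simp only [dictFun, Bool.xor_true]
    rfl
  have h1 := abs_le.1 (abs_freq_run_sub_le hD hη t ht false)
  have h2 := abs_le.1 (abs_freq_run_sub_le hD hη t ht true)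
  have h3 := freq_hasJump_mul_le (q := q) hD0 t
  rw [← le_div_iff₀ (by positivity)] at h3
  rw [hy, hno, abs_le]
  constructor <;> linarith [h1.1, h1.2, h2.1, h2.2]

theorem eventually_bounds (δ : ℝ) : ∃ n₀ : ℕ, ∀ n : ℕ, n₀ ≤ n →
    16 ≤ Real.log n ∧ 64 / δ ≤ Real.log n ∧ Real.log n ^ 2 ≤ √n ∧ 64 ≤ √(n : ℝ) ∧
      16 / δ ≤ n := by
  have hlog := Real.tendsto_log_atTop.comp (tendsto_natCast_atTop_atTop (R := ℝ))
  have h4 : ∀ᶠ n : ℕ in Filter.atTop, Real.log n ^ 4 ≤ n := by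
    have := (Real.isLittleO_pow_log_id_atTop (n := 4)).bound (c := 1) one_pos
    have := (tendsto_natCast_atTop_atTop (R := ℝ)).eventually this
    filter_upwards [this] with n hn
    have hn' : |Real.log n ^ 4| ≤ |(n : ℝ)| := by simpa using hn
    exact (le_abs_self _).trans (hn'.trans (abs_of_nonneg (Nat.cast_nonneg n)).le)
  have := (((hlog.eventually_ge_atTop 16).and (hlog.eventually_ge_atTop (64 / δ))).and
    (h4.and ((tendsto_natCast_atTop_atTop (R := ℝ)).eventually_ge_atTop (64 ^ 2)))).and
    ((tendsto_natCast_atTop_atTop (R := ℝ)).eventually_ge_atTop (16 / δ))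
  obtain ⟨n₀, h⟩ := Filter.eventually_atTop.1 this
  refine ⟨n₀, fun n hn => ?_⟩
  obtain ⟨⟨⟨h1, h2⟩, h3, h5⟩, h6⟩ := h n hn
  refine ⟨h1, h2, Real.le_sqrt_of_sq_le ?_, Real.le_sqrt_of_sq_le h5, h6⟩
  rw [← pow_mul]
  exact h3

/-- For u in [0,1], e^(u/2) ≤ 1/(1 - u/2) ≤ 1 + u. -/
theorem exp_le_one_add_pow {u : ℝ} (h0 : 0 ≤ u) (h1 : u ≤ 1) (k : ℕ) :
    Real.exp (k * (u / 2)) ≤ (1 + u) ^ k := by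
  rw [Real.exp_nat_mul]
  refine pow_le_pow_left₀ (Real.exp_pos _).le ?_ k
  have h := Real.one_sub_le_exp_neg (u / 2)
  have hpos : 0 < 1 - u / 2 := by linarith
  rw [Real.exp_neg] at h
  have h2 : Real.exp (u / 2) ≤ (1 - u / 2)⁻¹ := (le_inv_comm₀ hpos (Real.exp_pos _)).1 h
  refine h2.trans ?_
  rw [inv_le_comm₀ hpos (by linarith), inv_le_iff_one_le_mul₀ (by linarith)]
  nlinarith

theorem indistinguishable {δ : ℝ} (hδ : 0 < δ) : ∃ n₀ : ℕ, ∀ (n : ℕ) [NeZero n], n₀ ≤ n →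
      ∀ q : ℕ, (q : ℝ) ≤ (n : ℝ) ^ (1 / 3 : ℝ) / Real.log (n : ℝ) ^ 2 →
      ∀ A : RandAlg n, A.MakesAtMost q →
        |prob (A.outputOn (distYes n)) {true} - prob (A.outputOn (distNo n)) {true}| ≤ δ := by
  obtain ⟨n₀, hn₀⟩ := eventually_bounds δ
  refine ⟨n₀, fun n _ hn q hq A hA => ?_⟩
  obtain ⟨hL16, hLδ, hLsq, hn64, hnδ⟩ := hn₀ n hn
  set L := Real.log n with hL
  have hn0 : (0 : ℝ) < n := by exact_mod_cast Nat.pos_of_ne_zero (NeZero.ne n)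
  have hL0 : 0 < L := by linarith
  have hs0 : 0 < √(n : ℝ) := by linarith
  have hss : √(n : ℝ) * √n = n := Real.mul_self_sqrt hn0.le
  have hq3 : (q : ℝ) ^ 3 ≤ n / L ^ 6 := by
    have h := pow_le_pow_left₀ (Nat.cast_nonneg q) hq 3
    rw [div_pow, ← Real.rpow_natCast ((n : ℝ) ^ (1 / 3 : ℝ)), ← Real.rpow_mul hn0.le] at h
    norm_num at h
    rw [← pow_mul] at h
    exact h
  have hq3n : (q : ℝ) ^ 3 ≤ n :=
    hq3.trans (div_le_self hn0.le (one_le_pow₀ (by linarith)))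
  -- Ensures that at least √n/2 variables of a term or clause stay free after `q` of them are
  -- frozen.
  have hqs : (q : ℝ) ≤ √n / 4 := by
    by_contra hlt
    push Not at hlt
    have h1 : (√(n : ℝ) / 4) ^ 3 < q ^ 3 := pow_lt_pow_left₀ hlt (by positivity) (by norm_num)
    have h2 : (n : ℝ) ≤ (√n / 4) ^ 3 := by
      have : (√(n : ℝ) / 4) ^ 3 = n * (√n / 64) := by
        calc (√(n : ℝ) / 4) ^ 3 = (√n * √n) * (√n / 64) := by ring
          _ = _ := by rw [hss]
      rw [this]
      exact le_mul_of_one_le_right hn0.le (by linarith)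
    linarith
  -- This choice balances the two errors: (1 + D/n)^(√n/2) ≥ exp(L²/4) ≥ n² beats the 4q² of the
  -- union bound, and q^(3/2) ≤ √n/L³ makes the core loss at most 16/L.
  set D : ℝ := √n * L ^ 2 with hDdef
  have hD : √n ≤ D := le_mul_of_one_le_right hs0.le (one_le_pow₀ (by linarith))
  have hsq : √(q : ℝ) * q ≤ √n / L ^ 3 := by
    refine abs_le_of_sq_le_sq' ?_ (by positivity) |>.2
    calc (√(q : ℝ) * q) ^ 2 = (√(q : ℝ)) ^ 2 * (q : ℝ) ^ 2 := by ring
      _ = (q : ℝ) ^ 3 := by rw [Real.sq_sqrt (Nat.cast_nonneg _)]; ring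
      _ ≤ n / L ^ 6 := hq3
      _ = (√(n : ℝ) / L ^ 3) ^ 2 := by rw [div_pow, Real.sq_sqrt hn0.le]; ring
  have hη : 16 * D * √q * q / n ≤ 16 / L := by
    rw [div_le_iff₀ hn0]
    calc 16 * D * √q * q = 16 * D * (√q * q) := by ring
      _ ≤ 16 * D * (√n / L ^ 3) := by gcongr
      _ = 16 / L * (√n * √n) := by rw [hDdef]; field_simp
      _ = 16 / L * n := by rw [hss]
  have hη1 : 16 * D * √q * q / n ≤ 1 := hη.trans ((div_le_one hL0).2 hL16)
  have hu : D / n = L ^ 2 / √n := by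
    rw [hDdef, div_eq_div_iff hn0.ne' hs0.ne']
    calc √n * L ^ 2 * √n = L ^ 2 * (√n * √n) := by ring
      _ = _ := by rw [hss]
  have hk : √(n : ℝ) / 2 ≤ ((width n - q : ℕ) : ℝ) := by
    have h1 : √(n : ℝ) ≤ width n + 1 := by
      have h := Nat.lt_succ_sqrt n
      rw [Real.sqrt_le_left (by positivity)]
      exact_mod_cast (by rw [sq]; exact h.le : n ≤ (Nat.sqrt n + 1) ^ 2)
    have h2 : ((width n : ℕ) : ℝ) ≤ ((width n - q : ℕ) : ℝ) + q := by
      exact_mod_cast (by omega : width n ≤ width n - q + q)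
    linarith
  have hB : (n : ℝ) ^ 2 ≤ (1 + D / n) ^ (width n - q) := by
    rw [hu]
    refine le_trans ?_ (exp_le_one_add_pow (by positivity) ((div_le_one hs0).2 hLsq) _)
    calc (n : ℝ) ^ 2 = Real.exp (2 * L) := by
          rw [mul_comm, Real.exp_mul, hL, Real.exp_log hn0]; norm_num
      _ ≤ Real.exp (√n / 2 * (L ^ 2 / √n / 2)) := by
          refine Real.exp_le_exp.2 ?_
          have : √(n : ℝ) / 2 * (L ^ 2 / √n / 2) = L ^ 2 / 4 := by field_simp; norm_num
          rw [this]
          nlinarith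
      _ ≤ _ := by gcongr
  have hn1 : (1 : ℝ) ≤ n := by nlinarith
  have hjump : 4 * (q : ℝ) ^ 2 / (1 + D / n) ^ (width n - q) ≤ 4 / n := by
    rw [div_le_div_iff₀ (lt_of_lt_of_le (by positivity) hB) hn0]
    have h1 : (q : ℝ) ^ 2 ≤ n := by
      calc (q : ℝ) ^ 2 ≤ (√(n : ℝ) / 4) ^ 2 := by gcongr
        _ = (n : ℝ) / 16 := by rw [div_pow, Real.sq_sqrt hn0.le]; norm_num
        _ ≤ (n : ℝ) := by linarith
    nlinarith
  have hδ1 : 16 / L ≤ δ / 4 := by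
    rw [div_le_iff₀ hL0]
    rw [div_le_iff₀ hδ] at hLδ
    linarith
  have hδ2 : 4 / (n : ℝ) ≤ δ / 4 := by
    rw [div_le_iff₀ hn0]
    rw [div_le_iff₀ hδ] at hnδ
    linarith
  have key : ∀ t ∈ A.support,
      |prob (distYes n) {f | t.run f = true} - prob (distNo n) {f | t.run f = true}| ≤ δ :=
    fun t ht => (abs_prob_run_sub_le hD hη1 t (hA t ht)).trans (by linarith)
  have a1 := prob_outputOn_le A (distYes n) (distNo n) hδ.le fun t ht => by
    linarith [(abs_le.1 (key t ht)).2]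
  have a2 := prob_outputOn_le A (distNo n) (distYes n) hδ.le fun t ht => by
    linarith [(abs_le.1 (key t ht)).1]
  rw [abs_le]
  constructor <;> linarith

/-! ### Violating edges -/

/-- `x` is the lower end of an edge violated by the function built from anti-dictators, in the
direction of the anti-dictator selected at `x`. -/
def Violating {n : ℕ} (ω : (Terms n × Clauses n) × Dicts n) (x : Fin n → Bool) : Prop :=
  ∃ i j, x (ω.2 i j) = false ∧ Mid x ∧ Mid (Function.update x (ω.2 i j) true) ∧
    mux ω.1.1 ω.1.2 x = .pair i j ∧
    mux ω.1.1 ω.1.2 (Function.update x (ω.2 i j) true) = .pair i j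

/-- A monotone `g` errs at an end of each violated edge. Either end determines the pair by the
multiplexer, hence the direction and the edge, so the edges form a matching and distinct lower ends
yield distinct errors. -/
theorem freq_violating_le_dist {n : ℕ} (ω : (Terms n × Clauses n) × Dicts n) (g : BoolFun n)
    (hg : Monotone g) : freq (Violating ω) ≤ dist (dictFun true ω) g := by
  have hsel : ∀ x, ∃ k : Fin n → Bool, Violating ω x →
      ∃ i j, x (ω.2 i j) = false ∧ mux ω.1.1 ω.1.2 x = .pair i j ∧
        mux ω.1.1 ω.1.2 k = .pair i j ∧
        (k = x ∨ k = Function.update x (ω.2 i j) true) ∧ dictFun true ω k ≠ g k := by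
    intro x
    by_cases hx : Violating ω x
    swap
    · exact ⟨x, fun h => absurd h hx⟩
    obtain ⟨i, j, h0, hm, hm', e, e'⟩ := hx
    set y := Function.update x (ω.2 i j) true with hy
    have hfx : dictFun true ω x = true := by
      simp [dictFun, muxFun_of_mid _ hm, e, muxVal, h0]
    have hfy : dictFun true ω y = false := by
      have hyk : y (ω.2 i j) = true := by rw [hy, Function.update_self]
      simp [dictFun, muxFun_of_mid _ hm', e', muxVal, hyk]
    have hxy : x ≤ y := by
      rw [hy, le_update_iff]
      exact ⟨Bool.le_true _, fun _ _ => le_rfl⟩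
    by_cases hgx : g x = true
    · have hgy : g y = true := by
        have := hg hxy
        rw [hgx] at this
        exact top_le_iff.1 this
      exact ⟨y, fun _ => ⟨i, j, h0, e, e', Or.inr rfl, by simp [hfy, hgy]⟩⟩
    · exact ⟨x, fun _ => ⟨i, j, h0, e, e, Or.inl rfl, by rw [hfx]; exact fun h => hgx h.symm⟩⟩
  choose φ hφ using hsel
  unfold freq dist
  rw [Fintype.card_fun, Fintype.card_bool, Fintype.card_fin]
  push_cast
  refine div_le_div_of_nonneg_right (Nat.cast_le.2 ?_) (by positivity)
  refine Finset.card_le_card_of_injOn φ (fun x hx => ?_) ?_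
  · have hx' : Violating ω x := by simpa using hx
    obtain ⟨i, j, -, -, -, -, h⟩ := hφ x hx'
    simpa using h
  · intro x hx x' hx' hxx
    have hx : Violating ω x := by simpa using hx
    have hx' : Violating ω x' := by simpa using hx'
    obtain ⟨i, j, h0, -, e, h, -⟩ := hφ x hx
    obtain ⟨i', j', h0', -, e', h', -⟩ := hφ x' hx'
    rw [hxx, e'] at e
    injection e with e1 e2
    subst e1 e2
    -- In the mixed cases a lower end would have bit 1 in the direction of its edge.
    rcases h with h | h <;> rcases h' with h' | h'
    · rw [← h, hxx, h']
    · rw [hxx, h'] at h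
      rw [← h] at h0
      simp at h0
    · rw [← hxx, h] at h'
      rw [← h'] at h0'
      simp at h0'
    · rw [hxx, h'] at h
      funext k
      by_cases hk : k = ω.2 i' j'
      · rw [hk, h0, h0']
      · have := congrFun h k
        simpa [hk] using this.symm

/-! ### Independence -/

theorem freq_and {α β : Type} [Fintype α] [Fintype β] (P : α → Prop) (Q : β → Prop) :
    freq (fun p : α × β => P p.1 ∧ Q p.2) = freq P * freq Q := by
  rw [freq_eq_card_div (s := Finset.univ.filter P ×ˢ Finset.univ.filter Q) (by simp),
    Finset.card_product, Fintype.card_prod]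
  unfold freq
  push_cast
  rw [mul_div_mul_comm]

theorem freq_marginal {ι α : Type} [Fintype ι] [DecidableEq ι] [Fintype α] [Nonempty α]
    (P : α → Prop) (i : ι) : freq (fun c : ι → α => P (c i)) = freq P := by
  have h := sum_card_slice (fun c : ι → α => c i) (fun c v => Function.update c i v) (by simp)
    (by simp) (by simp) fun c => P (c i)
  simp only [Function.update_self, Finset.sum_const, Finset.card_univ, nsmul_eq_mul] at h
  unfold freq
  rw [div_eq_div_iff (by exact_mod_cast Fintype.card_ne_zero)
    (by exact_mod_cast Fintype.card_ne_zero)]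
  linarith

theorem freq_distinguished {ι α : Type} [Fintype ι] [DecidableEq ι] [Fintype α] (P Q : α → Prop)
    (i : ι) : freq (fun c : ι → α => P (c i) ∧ ∀ i', i' ≠ i → Q (c i')) =
      freq P * freq Q ^ (Fintype.card ι - 1) := by
  rw [freq_eq_card_div (s := Fintype.piFinset fun i' =>
    if i' = i then Finset.univ.filter P else Finset.univ.filter Q), Fintype.card_piFinset,
    Fintype.card_pi]
  · push_cast
    rw [← Finset.prod_div_distrib, ← Finset.mul_prod_erase _ _ (Finset.mem_univ i), if_pos rfl,
      Finset.prod_congr rfl fun i' hi' => by rw [if_neg (Finset.ne_of_mem_erase hi')],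
      Finset.prod_const, Finset.card_erase_of_mem (Finset.mem_univ i), Finset.card_univ]
    rfl
  · intro c
    rw [Fintype.mem_piFinset]
    refine ⟨fun h => ⟨by simpa using h i, fun i' hi' => by simpa [hi'] using h i'⟩, fun h i' => ?_⟩
    by_cases hi' : i' = i
    · subst hi'; simpa using h.1
    · simpa [hi'] using h.2 i' hi'

theorem freq_forall_value {m n : ℕ} (x : Fin n → Bool) (b : Bool) :
    freq (fun v : Fin m → Fin n => ∀ k, x (v k) = b) =
      (((Finset.univ.filter fun k => x k = b).card : ℝ) / n) ^ m := by
  rw [freq_eq_card_div (s := Fintype.piFinset fun _ => Finset.univ.filter fun k => x k = b)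
    (by simp [Fintype.mem_piFinset]), Fintype.card_piFinset]
  simp [div_pow]

theorem freq_termSat {n : ℕ} (x : Fin n → Bool) :
    freq (fun v : Fin (width n) → Fin n => TermSat v x) = ((weight x : ℝ) / n) ^ width n :=
  freq_forall_value x true

theorem freq_not_clauseSat {n : ℕ} (x : Fin n → Bool) :
    freq (fun v : Fin (width n) → Fin n => ¬ ClauseSat v x) =
      (((n : ℝ) - weight x) / n) ^ width n := by
  rw [← card_false_eq, ← freq_forall_value]
  simp [ClauseSat]

theorem freq_not {α : Type} [Fintype α] [Nonempty α] (P : α → Prop) :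
    freq (fun a => ¬ P a) = 1 - freq P := by
  linarith [freq_add_not P]

theorem freq_clauseSat {n : ℕ} [NeZero n] (x : Fin n → Bool) :
    freq (fun v : Fin (width n) → Fin n => ClauseSat v x) =
      1 - (((n : ℝ) - weight x) / n) ^ width n := by
  rw [← freq_not_clauseSat, freq_not]
  ring

/-! ### Numerical estimates in the middle layers -/

theorem exp_neg_two_mul_le {z : ℝ} (h0 : 0 ≤ z) (h1 : z ≤ 1 / 2) :
    Real.exp (-(2 * z)) ≤ 1 - z := by
  rw [Real.exp_neg, inv_le_iff_one_le_mul₀ (Real.exp_pos _)]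
  have := Real.add_one_le_exp (2 * z)
  nlinarith

theorem width_le_sqrt (n : ℕ) : (width n : ℝ) ≤ √n :=
  Real.nat_sqrt_le_real_sqrt

/-- `numTerms n` is 2^m for m = `width n`, so this bounds (2y)^m ≥ (1 - 2/√n)^m below by a constant:
layers within √n of the middle change the probability of satisfying a term only by a constant
factor. -/
theorem le_pow_width {n : ℕ} {y : ℝ} (hn : 4 ≤ √(n : ℝ)) (hy : 1 / 2 - 1 / √n ≤ y) :
    Real.exp (-4) / numTerms n ≤ y ^ width n := by
  have hs : 0 < √(n : ℝ) := by linarith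
  have h1 : Real.exp (-(2 * (2 / √n))) ≤ 2 * y := by
    refine (exp_neg_two_mul_le (by positivity) ?_).trans ?_
    · rw [div_le_iff₀ hs]; linarith
    · have : 2 / √(n : ℝ) = 2 * (1 / √n) := by ring
      linarith
  have h2 := pow_le_pow_left₀ (Real.exp_pos _).le h1 (width n)
  rw [mul_pow, ← Real.exp_nat_mul] at h2
  have h3 : Real.exp (-4) ≤ Real.exp (width n * -(2 * (2 / √n))) := by
    refine Real.exp_le_exp.2 ?_
    have h : (width n : ℝ) * (2 * (2 / √n)) ≤ √n * (2 * (2 / √n)) := by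
      gcongr
      exact width_le_sqrt n
    have h' : √(n : ℝ) * (2 * (2 / √n)) = 4 := by field_simp; norm_num
    linarith
  rw [div_le_iff₀ (by positivity)]
  push_cast
  linarith

theorem pow_width_le {n : ℕ} {y : ℝ} (hn : 4 ≤ √(n : ℝ)) (hy0 : 0 ≤ y)
    (hy : y ≤ 1 / 2 + 1 / √n) : y ^ width n ≤ Real.exp 2 / numTerms n := by
  have hs : 0 < √(n : ℝ) := by linarith
  have h1 : 2 * y ≤ Real.exp (2 / √n) := by
    have h := Real.add_one_le_exp (2 / √(n : ℝ))
    have : 2 / √(n : ℝ) = 2 * (1 / √n) := by ring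
    linarith
  have h2 := pow_le_pow_left₀ (by positivity) h1 (width n)
  rw [mul_pow, ← Real.exp_nat_mul] at h2
  have h3 : Real.exp (width n * (2 / √n)) ≤ Real.exp 2 := by
    refine Real.exp_le_exp.2 ?_
    have h : (width n : ℝ) * (2 / √n) ≤ √n * (2 / √n) := by
      gcongr
      exact width_le_sqrt n
    have h' : √(n : ℝ) * (2 / √n) = 2 := by field_simp
    linarith
  rw [le_div_iff₀ (by positivity)]
  push_cast
  linarith

/-- None of the other N - 1 terms (or clauses) interferes: each does with probability at most e²/N,
which is at most 1/2 because N ≥ 16. -/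
theorem le_one_sub_pow {n : ℕ} {y : ℝ} (hn : 4 ≤ √(n : ℝ)) (hy0 : 0 ≤ y)
    (hy : y ≤ 1 / 2 + 1 / √n) :
    Real.exp (-(2 * Real.exp 2)) ≤ (1 - y ^ width n) ^ (numTerms n - 1) := by
  have hle := pow_width_le hn hy0 hy
  have hw : 4 ≤ width n := by
    have h16 : 16 ≤ n := by
      have : (4 : ℝ) ^ 2 ≤ n := (Real.le_sqrt' (by norm_num)).1 hn
      norm_num at this
      exact_mod_cast this
    exact Nat.le_sqrt.2 (by omega)
  have hN : (16 : ℝ) ≤ numTerms n := by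
    have : 2 ^ 4 ≤ numTerms n := Nat.pow_le_pow_right (by norm_num) hw
    exact_mod_cast this
  have hN0 : (0 : ℝ) < numTerms n := by linarith
  have hexp : Real.exp 2 ≤ 8 := by
    have h := Real.exp_one_lt_d9
    have : Real.exp 2 = Real.exp 1 * Real.exp 1 := by rw [← Real.exp_add]; norm_num
    rw [this]
    nlinarith [Real.exp_pos 1]
  have hz0 : 0 ≤ y ^ width n := by positivity
  have hz : y ^ width n ≤ 1 / 2 := hle.trans (by rw [div_le_iff₀ hN0]; linarith)
  have h := pow_le_pow_left₀ (Real.exp_pos _).le (exp_neg_two_mul_le hz0 hz) (numTerms n - 1)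
  refine le_trans ?_ h
  rw [← Real.exp_nat_mul]
  refine Real.exp_le_exp.2 ?_
  have h1 : ((numTerms n - 1 : ℕ) : ℝ) * y ^ width n ≤ numTerms n * y ^ width n := by
    gcongr
    exact Nat.sub_le _ _
  rw [le_div_iff₀ hN0] at hle
  linarith

/-! ### The probability that a point is violating -/

/-- `x` and its upper neighbours lie in the middle layers. -/
def Balanced {n : ℕ} (x : Fin n → Bool) : Prop :=
  (n : ℝ) / 2 - √n ≤ weight x ∧ (weight x : ℝ) + 1 ≤ n / 2 + √n

theorem weight_update_true {n : ℕ} {x : Fin n → Bool} {k : Fin n} (h : x k = false) :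
    weight (Function.update x k true) = weight x + 1 := by
  have : (Finset.univ.filter fun l => Function.update x k true l = true) =
      insert k (Finset.univ.filter fun l => x l = true) := by
    ext l
    by_cases hl : l = k
    · subst hl; simp
    · simp [hl]
  unfold weight
  rw [this, Finset.card_insert_of_notMem (by simp [h])]

theorem le_update_true {n : ℕ} (x : Fin n → Bool) (k : Fin n) : x ≤ Function.update x k true := by
  rw [le_update_iff]
  exact ⟨Bool.le_true _, fun _ _ => le_rfl⟩

/-- The edge at `x` in direction `k` is violated because of the pair `(i, j)`. -/
def ViolatedBy {n : ℕ} (x : Fin n → Bool) (i j : Fin (numTerms n)) (k : Fin n)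
    (ω : (Terms n × Clauses n) × Dicts n) : Prop :=
  ((TermSat (ω.1.1 i) x ∧ ∀ i', i' ≠ i → ¬ TermSat (ω.1.1 i') (Function.update x k true)) ∧
    (¬ ClauseSat (ω.1.2 i j) (Function.update x k true) ∧
      ∀ j', j' ≠ j → ClauseSat (ω.1.2 i j') x)) ∧ ω.2 i j = k

/-- `ViolatedBy` imposes each condition at the end of the edge where it is stronger, so it holds at
both ends. The conditions concern different random variables, so their probabilities multiply. -/
theorem ViolatedBy.mux_eq {n : ℕ} {x : Fin n → Bool} {i j : Fin (numTerms n)} {k : Fin n}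
    {ω : (Terms n × Clauses n) × Dicts n} (h : ViolatedBy x i j k ω) {y : Fin n → Bool}
    (h1 : x ≤ y) (h2 : y ≤ Function.update x k true) : mux ω.1.1 ω.1.2 y = .pair i j := by
  obtain ⟨⟨⟨a, b⟩, c, d⟩, -⟩ := h
  refine mux_pair (a.mono h1) (fun i' hi' => ?_) (fun hc => c (hc.mono h2)) fun j' hj' => ?_
  · by_contra hne
    exact b i' hne (hi'.mono h2)
  · by_contra hne
    exact hj' ((d j' hne).mono h1)

theorem ViolatedBy.violating {n : ℕ} {x : Fin n → Bool} (hx : Balanced x)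
    {i j : Fin (numTerms n)} {k : Fin n} (hk : x k = false)
    {ω : (Terms n × Clauses n) × Dicts n} (h : ViolatedBy x i j k ω) : Violating ω x := by
  refine ⟨i, j, ?_⟩
  rw [h.2]
  refine ⟨hk, ⟨?_, ?_⟩, ⟨?_, ?_⟩, h.mux_eq le_rfl (le_update_true x k),
    h.mux_eq (le_update_true x k) le_rfl⟩
  · linarith [hx.2]
  · linarith [hx.1]
  · rw [weight_update_true hk]; push_cast; linarith [hx.2]
  · rw [weight_update_true hk]; push_cast; linarith [hx.1]

theorem freq_violatedBy {n : ℕ} [NeZero n] {x : Fin n → Bool} (i j : Fin (numTerms n)) {k : Fin n}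
    (hk : x k = false) : freq (ViolatedBy x i j k) =
      ((weight x : ℝ) / n) ^ width n *
        (1 - ((weight x + 1 : ℝ) / n) ^ width n) ^ (numTerms n - 1) *
      ((((n : ℝ) - (weight x + 1)) / n) ^ width n *
        (1 - (((n : ℝ) - weight x) / n) ^ width n) ^ (numTerms n - 1)) * (1 / n) := by
  have e1 := freq_distinguished (fun v : Fin (width n) → Fin n => TermSat v x)
    (fun v => ¬ TermSat v (Function.update x k true)) i
  have e2 := freq_distinguished
    (fun v : Fin (width n) → Fin n => ¬ ClauseSat v (Function.update x k true))
    (fun v => ClauseSat v x) j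
  have e3 := freq_marginal (fun r : Fin (numTerms n) → Fin (width n) → Fin n =>
    ¬ ClauseSat (r j) (Function.update x k true) ∧ ∀ j', j' ≠ j → ClauseSat (r j') x) i
  have e4 := freq_marginal (fun r : Fin (numTerms n) → Fin n => r j = k) i
  have e5 := freq_marginal (ι := Fin (numTerms n)) (fun a : Fin n => a = k) j
  have e6 : freq (fun a : Fin n => a = k) = 1 / n := by
    rw [freq_eq_card_div (s := {k}) (by simp)]
    simp
  rw [freq_not, freq_termSat, freq_termSat, weight_update_true hk] at e1
  rw [freq_not_clauseSat, freq_clauseSat, weight_update_true hk] at e2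
  rw [Fintype.card_fin] at e1 e2
  push_cast at e1 e2
  have e7 := freq_and (fun T : Terms n => TermSat (T i) x ∧
      ∀ i', i' ≠ i → ¬ TermSat (T i') (Function.update x k true))
    (fun C : Clauses n => ¬ ClauseSat (C i j) (Function.update x k true) ∧
      ∀ j', j' ≠ j → ClauseSat (C i j') x)
  have e8 := freq_and (fun TC : Terms n × Clauses n => (TermSat (TC.1 i) x ∧
      ∀ i', i' ≠ i → ¬ TermSat (TC.1 i') (Function.update x k true)) ∧
      ¬ ClauseSat (TC.2 i j) (Function.update x k true) ∧
      ∀ j', j' ≠ j → ClauseSat (TC.2 i j') x) (fun κ : Dicts n => κ i j = k)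
  rw [e7, e1, e3, e2, e4, e5, e6] at e8
  exact e8

/-- Lower bound for the probability that a given balanced point is violating. -/
def violationRate : ℝ := (Real.exp (-4) * Real.exp (-(2 * Real.exp 2))) ^ 2 / 4

theorem violationRate_pos : 0 < violationRate := by
  unfold violationRate; positivity

theorem le_freq_violatedBy {n : ℕ} [NeZero n] (hn : 4 ≤ √(n : ℝ)) {x : Fin n → Bool}
    (hx : Balanced x) (i j : Fin (numTerms n)) {k : Fin n} (hk : x k = false) :
    4 * violationRate / ((numTerms n : ℝ) ^ 2 * n) ≤ freq (ViolatedBy x i j k) := by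
  have hs : 0 < √(n : ℝ) := by linarith
  have hn0 : (0 : ℝ) < n := by exact_mod_cast Nat.pos_of_ne_zero (NeZero.ne n)
  have hss : √(n : ℝ) / n = 1 / √n := by
    rw [div_eq_div_iff hn0.ne' hs.ne', one_mul]
    exact Real.mul_self_sqrt hn0.le
  have lo : ∀ w : ℝ, (n : ℝ) / 2 - √n ≤ w → 1 / 2 - 1 / √n ≤ w / n := fun w hw => by
    rw [← hss, le_div_iff₀ hn0, sub_mul, div_mul_cancel₀ _ hn0.ne']
    linarith
  have hi : ∀ w : ℝ, w ≤ (n : ℝ) / 2 + √n → w / n ≤ 1 / 2 + 1 / √n := fun w hw => by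
    rw [← hss, div_le_iff₀ hn0, add_mul, div_mul_cancel₀ _ hn0.ne']
    linarith
  obtain ⟨h1, h2⟩ := hx
  have hwn : (weight x : ℝ) ≤ n := by
    exact_mod_cast (Finset.card_le_univ _).trans (by simp)
  have a1 := le_pow_width hn (lo (weight x) h1)
  have a2 := le_one_sub_pow (y := (weight x + 1 : ℝ) / n) hn (by positivity) (hi _ h2)
  have a3 := le_pow_width hn (lo ((n : ℝ) - (weight x + 1)) (by linarith))
  have a4 := le_one_sub_pow (y := ((n : ℝ) - weight x) / n) hn
    (div_nonneg (by linarith) hn0.le) (hi _ (by linarith))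
  rw [freq_violatedBy i j hk]
  have hN : (0 : ℝ) < numTerms n := by positivity
  calc 4 * violationRate / ((numTerms n : ℝ) ^ 2 * n)
      = Real.exp (-4) / numTerms n * Real.exp (-(2 * Real.exp 2)) *
          (Real.exp (-4) / numTerms n * Real.exp (-(2 * Real.exp 2))) * (1 / n) := by
        unfold violationRate
        field_simp
    _ ≤ _ := by
        have p1 : 0 ≤ Real.exp (-4) / (numTerms n : ℝ) := by positivity
        have p2 := (Real.exp_pos (-(2 * Real.exp 2))).le
        refine mul_le_mul_of_nonneg_right ?_ (by positivity)
        exact mul_le_mul (mul_le_mul a1 a2 p2 (p1.trans a1)) (mul_le_mul a3 a4 p2 (p1.trans a3))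
          (mul_nonneg p1 p2) (mul_nonneg (p1.trans a1) (p2.trans a2))

theorem sum_freq_le_of_unique {α ι : Type} [Fintype α] (s : Finset ι) (E : ι → α → Prop)
    (V : α → Prop) (hV : ∀ i ∈ s, ∀ a, E i a → V a)
    (hu : ∀ a, ∀ i ∈ s, ∀ i' ∈ s, E i a → E i' a → i = i') :
    ∑ i ∈ s, freq (E i) ≤ freq V := by
  simp only [freq_eq_sum]
  rw [← Finset.sum_div, Finset.sum_comm]
  refine div_le_div_of_nonneg_right (Finset.sum_le_sum fun a _ => ?_) (Nat.cast_nonneg _)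
  rw [Finset.sum_boole]
  have h1 : (s.filter fun i => E i a).card ≤ 1 := by
    rw [Finset.card_le_one]
    intro i hi i' hi'
    rw [Finset.mem_filter] at hi hi'
    exact hu a i hi.1 i' hi'.1 hi.2 hi'.2
  split_ifs with hVa
  · exact_mod_cast h1
  · rw [Finset.filter_false_of_mem fun i hi h => hVa (hV i hi a h)]
    simp

/-- The events `ViolatedBy x i j k` are disjoint, since the multiplexer at `x` gives (i,j) and then
κ gives k. There are N² pairs and at least n/4 zeros k of `x`, which cancels the 4/(N²n) in the
bound for one event. -/
theorem le_freq_violating {n : ℕ} [NeZero n] (hn : 4 ≤ √(n : ℝ)) {x : Fin n → Bool}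
    (hx : Balanced x) :
    violationRate ≤ freq fun ω : (Terms n × Clauses n) × Dicts n => Violating ω x := by
  have hn0 : (0 : ℝ) < n := by exact_mod_cast Nat.pos_of_ne_zero (NeZero.ne n)
  have hN : (0 : ℝ) < numTerms n := by positivity
  set Z := Finset.univ.filter fun k => x k = false with hZ
  set s : Finset ((Fin (numTerms n) × Fin (numTerms n)) × Fin n) := Finset.univ ×ˢ Z with hs
  have hzero : ∀ p ∈ s, x p.2 = false := fun p hp => by
    simpa [hs, hZ] using hp
  have h1 := sum_freq_le_of_unique s
    (fun p (ω : (Terms n × Clauses n) × Dicts n) => ViolatedBy x p.1.1 p.1.2 p.2 ω)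
    (fun ω => Violating ω x) (fun p hp ω h => h.violating hx (hzero p hp))
    (fun ω p _ p' _ h h' => by
      have e := (h.mux_eq le_rfl (le_update_true x _)).symm.trans
        (h'.mux_eq le_rfl (le_update_true x _))
      injection e with e1 e2
      refine Prod.ext (Prod.ext e1 e2) ?_
      rw [← h.2, ← h'.2, e1, e2])
  refine le_trans ?_ h1
  have h2 := Finset.sum_le_sum fun p (hp : p ∈ s) =>
    le_freq_violatedBy hn hx p.1.1 p.1.2 (hzero p hp)
  refine le_trans ?_ h2
  rw [Finset.sum_const, nsmul_eq_mul, hs, Finset.card_product, Finset.card_univ, Fintype.card_prod,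
    Fintype.card_fin]
  have hZc : (n : ℝ) / 4 ≤ Z.card := by
    rw [hZ, card_false_eq]
    have hss : √(n : ℝ) * √n = n := Real.mul_self_sqrt hn0.le
    have := hx.2
    nlinarith
  push_cast
  have hr := violationRate_pos
  rw [mul_div_assoc', le_div_iff₀ (by positivity)]
  have : violationRate * ((2 : ℝ) ^ width n) ^ 2 * (n / 4) ≤
      violationRate * ((2 : ℝ) ^ width n) ^ 2 * Z.card := by gcongr
  nlinarith

/-! ### Most points are balanced -/

/-- The value `±1` of a bit. -/
def bitSign (b : Bool) : ℝ := if b then 1 else -1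

theorem sum_bitSign {n : ℕ} (x : Fin n → Bool) : ∑ k, bitSign (x k) = 2 * weight x - n := by
  unfold bitSign
  rw [Finset.sum_ite]
  have := card_false_eq x
  simp only [Finset.sum_const, nsmul_eq_mul, mul_one, Bool.not_eq_true, this, mul_neg]
  unfold weight
  ring

/-- Flipping bit `k` negates the summand. -/
theorem sum_bitSign_mul {n : ℕ} {k l : Fin n} (h : k ≠ l) :
    ∑ x : Fin n → Bool, bitSign (x k) * bitSign (x l) = 0 := by
  have hinv : Function.Involutive fun x : Fin n → Bool => Function.update x k (!(x k)) := by
    intro x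
    simp
  have e := Equiv.sum_comp hinv.toPerm fun x : Fin n → Bool => bitSign (x k) * bitSign (x l)
  have hneg : ∀ b, bitSign (!b) = -bitSign b := by rintro (_ | _) <;> simp [bitSign]
  have : ∀ x : Fin n → Bool, bitSign (Function.update x k (!(x k)) k) *
      bitSign (Function.update x k (!(x k)) l) = -(bitSign (x k) * bitSign (x l)) := fun x => by
    rw [Function.update_self, Function.update_of_ne h.symm, hneg, neg_mul]
  have e' := e.symm.trans (Finset.sum_congr rfl fun x _ => this x)
  rw [Finset.sum_neg_distrib] at e'
  linarith

theorem sum_sq_weight (n : ℕ) :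
    ∑ x : Fin n → Bool, (2 * (weight x : ℝ) - n) ^ 2 = (n : ℝ) * 2 ^ n := by
  simp only [← sum_bitSign, sq, Finset.sum_mul_sum]
  rw [Finset.sum_comm]
  have hsq : ∀ b, bitSign b * bitSign b = 1 := by rintro (_ | _) <;> simp [bitSign]
  have : ∀ k : Fin n, ∑ x : Fin n → Bool, ∑ l, bitSign (x k) * bitSign (x l) = 2 ^ n := by
    intro k
    rw [Finset.sum_comm, Finset.sum_eq_single k]
    · simp [hsq]
    · intro l _ hl
      exact sum_bitSign_mul hl.symm
    · simp
  simp [this]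

/-- Chebyshev: an unbalanced point has |2·weight - n| ≥ 2√n - 2, whose square is at least 2n when √n
≥ 4, while the mean square is n. -/
theorem half_le_freq_balanced {n : ℕ} (hn : 4 ≤ √(n : ℝ)) :
    1 / 2 ≤ freq (Balanced : (Fin n → Bool) → Prop) := by
  have hn0 : (0 : ℝ) < n := Real.sqrt_pos.1 (by linarith)
  have hss : √(n : ℝ) * √n = n := Real.mul_self_sqrt hn0.le
  obtain ⟨P, hP⟩ : ∃ P : (Fin n → Bool) → Prop, ∀ x, P x ↔ ¬ Balanced x := ⟨_, fun _ => Iff.rfl⟩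
  have h1 : ∀ x : Fin n → Bool,
      2 * (n : ℝ) * (if P x then 1 else 0) ≤ (2 * (weight x : ℝ) - n) ^ 2 := by
    intro x
    by_cases h : Balanced x
    · rw [if_neg (fun h' => (hP x).1 h' h), mul_zero]; positivity
    · rw [if_pos ((hP x).2 h), mul_one]
      have h2 : 2 * √(n : ℝ) - 2 ≤ |2 * (weight x : ℝ) - n| := by
        rw [le_abs]
        by_contra hc
        push Not at hc
        exact h ⟨by linarith, by linarith⟩
      rw [← sq_abs]
      have h3 := pow_le_pow_left₀ (by linarith : 0 ≤ 2 * √(n : ℝ) - 2) h2 2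
      nlinarith
  have h2 := Finset.sum_le_sum fun x (_ : x ∈ Finset.univ) => h1 x
  rw [sum_sq_weight, ← Finset.mul_sum] at h2
  have h3 : freq P ≤ 1 / 2 := by
    rw [freq_eq_sum, Fintype.card_fun, Fintype.card_bool, Fintype.card_fin]
    push_cast
    rw [div_le_iff₀ (by positivity)]
    have : (n : ℝ) * (2 * ∑ x : Fin n → Bool, if P x then (1 : ℝ) else 0) ≤
        n * 2 ^ n := by linarith
    have := le_of_mul_le_mul_left this hn0
    linarith
  linarith [freq_add_not (Balanced : (Fin n → Bool) → Prop), freq_mono fun x => (hP x).2]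

/-! ### Distance to monotonicity -/

/-- Reverse Markov: `z` is at most 1 on the event and below `t` off it. -/
theorem sum_div_card_le_freq_add {Ω : Type} [Fintype Ω] (z : Ω → ℝ) (hz : ∀ ω, z ω ≤ 1) {t : ℝ}
    (ht : 0 ≤ t) : (∑ ω, z ω) / Fintype.card Ω ≤ freq (fun ω => t ≤ z ω) + t := by
  have h : ∑ ω, z ω ≤ ∑ ω, ((if t ≤ z ω then (1 : ℝ) else 0) + t) := by
    refine Finset.sum_le_sum fun ω _ => ?_
    split_ifs with h
    · linarith [hz ω]
    · linarith
  rw [Finset.sum_add_distrib, Finset.sum_const, Finset.card_univ, nsmul_eq_mul] at h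
  refine (div_le_div_of_nonneg_right h (Nat.cast_nonneg _)).trans ?_
  rw [add_div, ← freq_eq_sum, mul_div_right_comm]
  gcongr
  exact mul_le_of_le_one_left ht (div_self_le_one _)

/-- The mean density of violating points is at least `violationRate / 2`, as half of the points are
balanced. Reverse Markov splits this equally between the distance and the probability. -/
theorem le_prob_isFar {n : ℕ} [NeZero n] (hn : 4 ≤ √(n : ℝ)) :
    violationRate / 4 ≤ prob (distNo n) {f | IsFar (violationRate / 4) f} := by
  have hr := violationRate_pos
  have h1 : violationRate / 2 ≤ (∑ ω : (Terms n × Clauses n) × Dicts n, freq (Violating ω)) /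
      Fintype.card ((Terms n × Clauses n) × Dicts n) := by
    have hsw : (∑ ω : (Terms n × Clauses n) × Dicts n, freq (Violating ω)) /
        Fintype.card ((Terms n × Clauses n) × Dicts n) =
        (∑ x : Fin n → Bool, freq fun ω : (Terms n × Clauses n) × Dicts n => Violating ω x) /
          Fintype.card (Fin n → Bool) := by
      simp only [freq_eq_sum, ← Finset.sum_div]
      rw [Finset.sum_comm, div_div, div_div, mul_comm]
    rw [hsw]
    have h2 : ∑ x : Fin n → Bool, violationRate * (if Balanced x then 1 else 0) ≤
        ∑ x : Fin n → Bool, freq fun ω : (Terms n × Clauses n) × Dicts n => Violating ω x := by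
      refine Finset.sum_le_sum fun x _ => ?_
      split_ifs with hx
      · rw [mul_one]; exact le_freq_violating hn hx
      · rw [mul_zero]; exact freq_nonneg _
    refine le_trans ?_ (div_le_div_of_nonneg_right h2 (Nat.cast_nonneg _))
    rw [← Finset.mul_sum, mul_div_assoc, ← freq_eq_sum]
    have := half_le_freq_balanced hn
    nlinarith
  have h2 := sum_div_card_le_freq_add
    (fun ω : (Terms n × Clauses n) × Dicts n => freq (Violating ω)) (fun ω => by
      refine div_le_one_of_le₀ ?_ (by positivity)
      exact_mod_cast Finset.card_le_univ _) (t := violationRate / 4) (by positivity)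
  rw [prob_distNo]
  have h3 : violationRate / 4 ≤ freq fun ω : (Terms n × Clauses n) × Dicts n =>
      violationRate / 4 ≤ freq (Violating ω) := by linarith
  refine h3.trans (freq_mono fun ω hω g hg => ?_)
  have := freq_violating_le_dist ω g hg
  simp only [dictFun, Bool.xor_true] at this
  exact hω.trans this

theorem exists_far : ∃ n₀ : ℕ, ∀ (n : ℕ) [NeZero n], n₀ ≤ n →
    violationRate / 4 ≤ prob (distNo n) {f | IsFar (violationRate / 4) f} := by
  refine ⟨16, fun n _ hn => le_prob_isFar (Real.le_sqrt_of_sq_le ?_)⟩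
  have : (16 : ℝ) ≤ n := by exact_mod_cast hn
  linarith

end

end MonoTesting

theorem mainTheorem1 :
    -- every function in the support of the first distribution is monotone
    (∀ (n : ℕ) [NeZero n], ∀ f ∈ (MonoTesting.distYes n).support, Monotone f) ∧
    -- no algorithm with at most `n^{1/3} / log² n` queries tells the distributions apart
    (∀ δ : ℝ, 0 < δ → ∃ n₀ : ℕ, ∀ (n : ℕ) [NeZero n], n₀ ≤ n →
      ∀ q : ℕ, (q : ℝ) ≤ (n : ℝ) ^ (1 / 3 : ℝ) / Real.log (n : ℝ) ^ 2 →
      ∀ A : MonoTesting.RandAlg n, A.MakesAtMost q →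
        |MonoTesting.prob (A.outputOn (MonoTesting.distYes n)) {true} -
          MonoTesting.prob (A.outputOn (MonoTesting.distNo n)) {true}| ≤ δ) ∧
    ∃ ε : ℝ, 0 < ε ∧
      -- a function from the second distribution is far from monotone with constant probability
      (∃ p : ℝ, 0 < p ∧ ∃ n₀ : ℕ, ∀ (n : ℕ) [NeZero n], n₀ ≤ n →
        p ≤ MonoTesting.prob (MonoTesting.distNo n) {f | MonoTesting.IsFar ε f}) ∧
      -- the lower bound for testing
      (∃ c : ℝ, 0 < c ∧ ∃ n₀ : ℕ, ∀ n : ℕ, n₀ ≤ n →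
        ∀ (q : ℕ) (A : MonoTesting.RandAlg n), A.MakesAtMost q → A.IsMonotonicityTester ε →
          c * ((n : ℝ) ^ (1 / 3 : ℝ) / Real.log (n : ℝ) ^ 2) ≤ (q : ℝ)) := by
  refine ⟨fun n _ => MonoTesting.monotone_of_mem_support_distYes n,
    fun δ hδ => MonoTesting.indistinguishable hδ, MonoTesting.violationRate / 4,
    div_pos MonoTesting.violationRate_pos four_pos,
    ⟨MonoTesting.violationRate / 4, div_pos MonoTesting.violationRate_pos four_pos,
      MonoTesting.exists_far⟩, ?_⟩
  have hp : 0 < MonoTesting.violationRate / 4 := div_pos MonoTesting.violationRate_pos four_pos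
  exact MonoTesting.tester_lower_bound hp (MonoTesting.indistinguishable (half_pos hp))
    MonoTesting.exists_far
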